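/- For $n\ge 3$ let $\overline{\mathcal M}_{0,n}$ denote the set of isomorphism classes of stable complex rational curves with $n$ marked points labelled by $0,\dots,n-1$. Such a curve is a finite tree of complex projective lines glued at nodes, with $n$ marked points that are distinct from each other and from the nodes, such that each line carries at least three distinguished points (nodes or marked points). For $n<3$ let $\overline{\mathcal M}_{0,n}$ be a point. For $0\le i\le n$ let $\partial_i:\overline{\mathcal M}_{0,n+1}\to\overline{\mathcal M}_{0,n}$ be the forgetful map: for $n\ge 3$ it erases the point marked by $i$, replaces each label $j>i$ by $j-1$, and then, if the component that carried the erased point is left with only two distinguished points, collapses that component; for $n<3$ it is the only map to a point. A $\Delta$-set is a sequence of sets $X_0,X_1,\dots$ with maps $\partial_i:X_n\to X_{n-1}$ ($n>0$, $0\le i\le n$) such that $\partial_i\partial_j=\partial_{j-1}\partial_i$ for $i<j$. It is uniquely fillable in dimension $n$ if for each sequence $(x_0,\dots,x_n)$ of elements of $X_{n-1}$ with $\partial_i(x_j)=\partial_{j-1}(x_i)$ for all $0\le i<j\le n$ there is a unique $y\in X_n$ with $\partial_i(y)=x_i$ for all $i$. Theorem. The sets $X_n=\overline{\mathcal M}_{0,n+1}$,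 $n\ge 0$, together with the forgetful maps $\partial_i$, form a $\Delta$-set which is uniquely fillable in all dimensions $n\ge 5$. Consequently, for $n>5$, the map $(\partial_0,\dots,\partial_{n-1}):\overline{\mathcal M}_{0,n}\to(\overline{\mathcal M}_{0,n-1})^n$ is injective, and its image is the set of all $(x_0,\dots,x_{n-1})$ with $\partial_i(x_j)=\partial_{j-1}(x_i)$ for all $0\le i<j\le n-1$. -/

import Mathlib

/-! ### `Δ`-sets -/

/-- A sequence of sets `X 0, X 1, …` with maps `d n i : X (n + 1) → X n`, `i = 0, …, n + 1`
(the `i`-th face of an `(n + 1)`-simplex), is a `Δ`-set if `∂ᵢ ∘ ∂ⱼ = ∂ⱼ₋₁ ∘ ∂ᵢ` for `i < j`. -/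
def IsDeltaSet (X : ℕ → Type*) (d : ∀ n : ℕ, Fin (n + 2) → X (n + 1) → X n) : Prop :=
  ∀ (n : ℕ) (i j : Fin (n + 3)) (hij : i < j) (x : X (n + 2)),
    d n (i.castLT (by omega)) (d (n + 1) j x) =
      d n (j.pred (Fin.ne_zero_of_lt hij)) (d (n + 1) i x)

/-- The simplicial equations `∂ᵢ xⱼ = ∂ⱼ₋₁ xᵢ` (`0 ≤ i < j ≤ n + 2`) for a sequence
`x₀, …, x_{n + 2}` of `(n + 1)`-simplices. -/
def SimplicialEquations (X : ℕ → Type*) (d : ∀ n : ℕ, Fin (n + 2) → X (n + 1) → X n) (n : ℕ)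
    (x : Fin (n + 3) → X (n + 1)) : Prop :=
  ∀ (i j : Fin (n + 3)) (hij : i < j),
    d n (i.castLT (by omega)) (x j) = d n (j.pred (Fin.ne_zero_of_lt hij)) (x i)

/-- Unique fillability in dimension `n`. (In dimensions `0` and `1`, where the simplicial
equations would take place in the absent set `X₋₁`, that set is read as a point.) -/
def UniquelyFillable (X : ℕ → Type*) (d : ∀ n : ℕ, Fin (n + 2) → X (n + 1) → X n) :
    ℕ → Prop
  | 0 => ∃! _y : X 0, True
  | 1 => ∀ x : Fin 2 → X 0, ∃! y : X 1, ∀ i, d 0 i y = x i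
  | n + 2 => ∀ x : Fin (n + 3) → X (n + 1), SimplicialEquations X d n x →
      ∃! y : X (n + 2), ∀ i, d (n + 1) i y = x i

/-! ### Suppressing a vertex of valency at most two in a tree -/

/-- Remove the vertex `v` of a graph and join its neighbours with each other. (If `v` has one
neighbour, this just deletes `v`; if it has two, the two edges at `v` become one edge.) -/
def SimpleGraph.suppress {V : Type} (G : SimpleGraph V) (v : V) : SimpleGraph {w : V // w ≠ v} where
  Adj a b := a ≠ b ∧ (G.Adj a b ∨ (G.Adj a v ∧ G.Adj v b))
  symm := ⟨fun _ _ h => ⟨h.1.symm, h.2.imp (fun h => h.symm) (fun h => ⟨h.2.symm, h.1.symm⟩)⟩⟩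
  loopless := ⟨fun _ h => h.1 rfl⟩

theorem SimpleGraph.suppress_isTree {V : Type} [Finite V] {G : SimpleGraph V} (hG : G.IsTree)
    {v u : V} (hu : G.Adj v u)
    (hdeg : ∀ a b c, G.Adj v a → G.Adj v b → G.Adj v c → a = b ∨ a = c ∨ b = c) :
    (G.suppress v).IsTree := by
  classical
  let f : V → {w : V // w ≠ v} := fun w => if h : w = v then ⟨u, hu.ne'⟩ else ⟨w, h⟩
  have fv : f v = ⟨u, hu.ne'⟩ := by simp [f]
  have fw : ∀ w (h : w ≠ v), f w = ⟨w, h⟩ := fun w h => by simp [f, h]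
  have step : ∀ a b, G.Adj a b → (G.suppress v).Reachable (f a) (f b) := by
    have key : ∀ b, G.Adj v b → (G.suppress v).Reachable (f v) (f b) := by
      intro b hb
      rw [fv, fw b hb.ne']
      by_cases hbu : u = b
      · subst hbu; exact SimpleGraph.Reachable.refl _
      · exact SimpleGraph.Adj.reachable
          ⟨fun h => hbu (congrArg Subtype.val h), Or.inr ⟨hu.symm, hb⟩⟩
    intro a b hab
    by_cases ha : a = v
    · subst ha; exact key b hab
    by_cases hb : b = v
    · subst hb; exact (key a hab.symm).symm
    rw [fw a ha, fw b hb]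
    exact SimpleGraph.Adj.reachable ⟨fun h => hab.ne (congrArg Subtype.val h), Or.inl hab⟩
  have walk : ∀ a b, G.Walk a b → (G.suppress v).Reachable (f a) (f b) := by
    intro a b p
    induction p with
    | nil => exact SimpleGraph.Reachable.refl _
    | cons h _ ih => exact (step _ _ h).trans ih
  have hconn : (G.suppress v).Connected := by
    have : Nonempty {w : V // w ≠ v} := ⟨⟨u, hu.ne'⟩⟩
    refine ⟨fun a b => ?_⟩
    obtain ⟨p⟩ := hG.connected.preconnected a.1 b.1
    have h := walk _ _ p
    rwa [fw a.1 a.2, fw b.1 b.2] at h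
  refine SimpleGraph.isTree_iff_connected_and_card.2 ⟨hconn, ?_⟩
  have h1 := hconn.card_vert_le_card_edgeSet_add_one
  have h2 := (SimpleGraph.isTree_iff_connected_and_card.1 hG).2
  have h3 : Nat.card {w : V // w ≠ v} + 1 = Nat.card V := by
    have := Set.ncard_add_ncard_compl ({v} : Set V)
    rw [Set.ncard_singleton] at this
    have h' : Nat.card {w : V // w ≠ v} = ({v}ᶜ : Set V).ncard := by
      rw [← Nat.card_coe_set_eq]; rfl
    omega
  have h4 : (G.suppress v).edgeSet ⊆ Sym2.map f '' (G.edgeSet \ {s(v, u)}) := by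
    intro e
    induction e using Sym2.ind with
    | h a b =>
      obtain ⟨a, ha⟩ := a
      obtain ⟨b, hb⟩ := b
      rintro ⟨hne, hab | ⟨hav, hvb⟩⟩
      · refine ⟨s(a, b), ⟨hab, ?_⟩, by simp [fw a ha, fw b hb]⟩
        intro h
        rcases Sym2.eq_iff.1 (Set.mem_singleton_iff.1 h) with ⟨h, _⟩ | ⟨_, h⟩
        · exact ha h
        · exact hb h
      · have hne' : a ≠ b := fun h => hne (Subtype.ext h)
        rcases hdeg u a b hu hav.symm hvb with h | h | h
        · subst h
          refine ⟨s(v, b), ⟨hvb, ?_⟩, by simp [fv, fw b hb]⟩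
          intro h
          rcases Sym2.eq_iff.1 (Set.mem_singleton_iff.1 h) with ⟨_, h⟩ | ⟨h, _⟩
          · exact hne' h.symm
          · exact ha h.symm
        · subst h
          refine ⟨s(a, v), ⟨hav, ?_⟩, by simp [fv, fw a ha]⟩
          intro h
          rcases Sym2.eq_iff.1 (Set.mem_singleton_iff.1 h) with ⟨h, _⟩ | ⟨h, _⟩
          · exact ha h
          · exact hne' h
        · exact absurd h hne'
  have h5 : (G.suppress v).edgeSet.ncard < G.edgeSet.ncard :=
    calc (G.suppress v).edgeSet.ncard
        ≤ (Sym2.map f '' (G.edgeSet \ {s(v, u)})).ncard := Set.ncard_le_ncard h4 (Set.toFinite _)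
      _ ≤ (G.edgeSet \ {s(v, u)}).ncard := Set.ncard_image_le (Set.toFinite _)
      _ < G.edgeSet.ncard := Set.ncard_sdiff_singleton_lt_of_mem hu (Set.toFinite _)
  rw [← Nat.card_coe_set_eq, ← Nat.card_coe_set_eq] at h5
  omega

/-! ### Trees of projective lines with marked points -/

/-- A tree of complex projective lines with nodal singularities and `n` marked points labelled by
`0, …, n - 1`. The projective line is `ℂ ∪ {∞}`, acted on by `GL₂(ℂ)` through Möbius
transformations. -/
structure MarkedCurve (n : ℕ) where
  /-- The set of irreducible components, each of which is a copy of `ℂ ∪ {∞}`. -/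
  V : Type
  finite : Finite V
  /-- Two components are adjacent if they meet (in a node). -/
  G : SimpleGraph V
  isTree : G.IsTree
  /-- For adjacent `v` and `w`, the node at which `v` and `w` meet is the point `node v w` of the
  line `v` glued to the point `node w v` of the line `w`. (Other values play no role.) -/
  node : V → V → OnePoint ℂ
  /-- The component that carries the point marked by `i`. -/
  comp : Fin n → V
  /-- The position of the point marked by `i` on its component. -/
  pt : Fin n → OnePoint ℂ
  node_inj : ∀ v w w', G.Adj v w → G.Adj v w' → node v w = node v w' → w = w'
  pt_inj : ∀ i j, comp i = comp j → pt i = pt j → i = j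
  pt_ne_node : ∀ i w, G.Adj (comp i) w → pt i ≠ node (comp i) w

namespace MarkedCurve

variable {n : ℕ}

/-- The distinguished points of the component `v`: the nodes and the marked points on it. -/
def special (C : MarkedCurve n) (v : C.V) : Set (OnePoint ℂ) :=
  {p | (∃ w, C.G.Adj v w ∧ C.node v w = p) ∨ ∃ i, C.comp i = v ∧ C.pt i = p}

/-- The component `v` has at least three distinguished points. -/
def StableAt (C : MarkedCurve n) (v : C.V) : Prop :=
  3 ≤ (C.special v).encard

/-- A curve is stable if each component has at least three distinguished points. -/
def IsStable (C : MarkedCurve n) : Prop :=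
  ∀ v, C.StableAt v

/-- An isomorphism of marked curves: a bijection between the components that respects incidence,
together with a Möbius transformation between corresponding components, such that nodes go to nodes
and marked points go to marked points with the same label. -/
structure Iso (C D : MarkedCurve n) where
  e : C.G ≃g D.G
  mob : C.V → GL (Fin 2) ℂ
  node_eq : ∀ v w, C.G.Adj v w → D.node (e v) (e w) = mob v • C.node v w
  comp_eq : ∀ i, D.comp i = e (C.comp i)
  pt_eq : ∀ i, D.pt i = mob (C.comp i) • C.pt i

/-- The identity isomorphism. -/
def Iso.refl (C : MarkedCurve n) : Iso C C :=
  ⟨RelIso.refl _, fun _ => 1, by simp, by simp, by simp⟩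

/-- The inverse isomorphism. -/
def Iso.symm {C D : MarkedCurve n} (φ : Iso C D) : Iso D C where
  e := φ.e.symm
  mob v := (φ.mob (φ.e.symm v))⁻¹
  node_eq v w h := by
    have := φ.node_eq (φ.e.symm v) (φ.e.symm w) (φ.e.symm.map_rel_iff.2 h)
    simp only [RelIso.apply_symm_apply] at this
    rw [this, inv_smul_smul]
  comp_eq i := by rw [φ.comp_eq, RelIso.symm_apply_apply]
  pt_eq i := by rw [φ.comp_eq, RelIso.symm_apply_apply, φ.pt_eq, inv_smul_smul]

/-- The composition of isomorphisms. -/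
def Iso.trans {C D E : MarkedCurve n} (φ : Iso C D) (ψ : Iso D E) : Iso C E where
  e := φ.e.trans ψ.e
  mob v := ψ.mob (φ.e v) * φ.mob v
  node_eq v w h := by
    rw [RelIso.trans_apply, RelIso.trans_apply, ψ.node_eq _ _ (φ.e.map_rel_iff.2 h),
      φ.node_eq _ _ h, mul_smul]
  comp_eq i := by rw [ψ.comp_eq, φ.comp_eq, RelIso.trans_apply]
  pt_eq i := by rw [ψ.pt_eq, φ.comp_eq, φ.pt_eq, mul_smul]

theorem Iso.special_subset {C D : MarkedCurve n} (φ : Iso C D) (v : C.V) :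
    (fun p => φ.mob v • p) '' C.special v ⊆ D.special (φ.e v) := by
  rintro _ ⟨p, ⟨w, hw, rfl⟩ | ⟨i, rfl, rfl⟩, rfl⟩
  · exact Or.inl ⟨φ.e w, φ.e.map_rel_iff.2 hw, φ.node_eq _ _ hw⟩
  · exact Or.inr ⟨i, φ.comp_eq i, φ.pt_eq i⟩

theorem Iso.stableAt {C D : MarkedCurve n} (φ : Iso C D) {v : C.V} (h : C.StableAt v) :
    D.StableAt (φ.e v) := by
  have h1 := Set.encard_le_encard (φ.special_subset v)
  rw [(MulAction.injective (φ.mob v)).encard_image] at h1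
  exact le_trans h h1

theorem Iso.isStable {C D : MarkedCurve n} (φ : Iso C D) (h : C.IsStable) : D.IsStable := by
  intro v
  have := φ.stableAt (h (φ.e.symm v))
  rwa [RelIso.apply_symm_apply] at this

theorem eq_or_of_not_stableAt {C : MarkedCurve n} {v : C.V} (hv : ¬ C.StableAt v)
    {p q r : OnePoint ℂ} (hp : p ∈ C.special v) (hq : q ∈ C.special v) (hr : r ∈ C.special v) :
    p = q ∨ p = r ∨ q = r := by
  by_contra! h
  refine hv ?_
  have h1 : ({p, q, r} : Set (OnePoint ℂ)).encard = 3 :=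
    Set.encard_eq_three.2 ⟨p, q, r, h.1, h.2.1, h.2.2, rfl⟩
  rw [StableAt, ← h1]
  refine Set.encard_le_encard ?_
  rintro x (rfl | rfl | rfl) <;> assumption

/-- Erasing the point marked by `i`; the labels `j > i` are replaced by `j - 1`. -/
def erase (C : MarkedCurve (n + 1)) (i : Fin (n + 1)) : MarkedCurve n where
  V := C.V
  finite := C.finite
  G := C.G
  isTree := C.isTree
  node := C.node
  comp j := C.comp (i.succAbove j)
  pt j := C.pt (i.succAbove j)
  node_inj := C.node_inj
  pt_inj _ _ h h' := Fin.succAbove_right_injective (C.pt_inj _ _ h h')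
  pt_ne_node _ _ h := C.pt_ne_node _ _ h

theorem node_mem {C : MarkedCurve n} {v w : C.V} (h : C.G.Adj v w) : C.node v w ∈ C.special v :=
  Or.inl ⟨w, h, rfl⟩

theorem pt_mem {C : MarkedCurve n} {v : C.V} {i : Fin n} (h : C.comp i = v) :
    C.pt i ∈ C.special v :=
  Or.inr ⟨i, h, rfl⟩

theorem adj_eq_or {C : MarkedCurve n} {v : C.V} (hv : ¬ C.StableAt v) (a b c : C.V)
    (ha : C.G.Adj v a) (hb : C.G.Adj v b) (hc : C.G.Adj v c) : a = b ∨ a = c ∨ b = c :=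
  (eq_or_of_not_stableAt hv (node_mem ha) (node_mem hb) (node_mem hc)).imp
    (C.node_inj _ _ _ ha hb) (Or.imp (C.node_inj _ _ _ ha hc) (C.node_inj _ _ _ hb hc))

theorem adj_eq_of_comp {C : MarkedCurve n} {v : C.V} (hv : ¬ C.StableAt v) {i : Fin n}
    (hi : C.comp i = v) {a b : C.V} (ha : C.G.Adj v a) (hb : C.G.Adj v b) : a = b := by
  rcases eq_or_of_not_stableAt hv (pt_mem hi) (node_mem ha) (node_mem hb) with h | h | h
  · subst hi; exact absurd h (C.pt_ne_node _ _ ha)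
  · subst hi; exact absurd h (C.pt_ne_node _ _ hb)
  · exact C.node_inj _ _ _ ha hb h

open Classical in
/-- Collapsing a component `v` with fewer than three distinguished points that meets another
component `u`: the component `v` disappears. If `v` carries a second node, with a component `w`,
then `u` and `w` now meet, at the points at which they met `v`. If `v` carries a marked point, then
this marked point is now placed at the point of `u` at which `u` met `v`. -/
noncomputable def collapse (C : MarkedCurve n) (v : C.V) (hv : ¬ C.StableAt v)
    (hu : ∃ u, C.G.Adj v u) : MarkedCurve n where
  V := {w : C.V // w ≠ v}
  finite := by have := C.finite; infer_instance
  G := C.G.suppress v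
  isTree := by
    have := C.finite
    exact SimpleGraph.suppress_isTree C.isTree hu.choose_spec (adj_eq_or hv)
  node w w' := if C.G.Adj w w' then C.node w w' else C.node w v
  comp j := if h : C.comp j = v then ⟨hu.choose, hu.choose_spec.ne'⟩ else ⟨C.comp j, h⟩
  pt j := if C.comp j = v then C.node hu.choose v else C.pt j
  node_inj := by
    rintro ⟨w, hw⟩ ⟨a, ha⟩ ⟨b, hb⟩ ⟨hwa, h1⟩ ⟨hwb, h2⟩ h
    have hwa' : w ≠ a := fun h => hwa (Subtype.ext h)
    have hwb' : w ≠ b := fun h => hwb (Subtype.ext h)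
    refine Subtype.ext ?_
    simp only at h h1 h2 ⊢
    by_cases h1' : C.G.Adj w a <;> by_cases h2' : C.G.Adj w b
    · simp only [h1', h2', if_true] at h
      exact C.node_inj _ _ _ h1' h2' h
    · simp only [h1', h2', if_true, if_false] at h
      have h3 := h2.resolve_left h2'
      exact absurd (C.node_inj _ _ _ h1' h3.1 h) ha
    · simp only [h1', h2', if_true, if_false] at h
      have h3 := h1.resolve_left h1'
      exact absurd (C.node_inj _ _ _ h3.1 h2' h).symm hb
    · have h3 := h1.resolve_left h1'
      have h4 := h2.resolve_left h2'
      rcases adj_eq_or hv w a b h3.1.symm h3.2 h4.2 with h | h | h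
      · exact absurd h hwa'
      · exact absurd h hwb'
      · exact h
  pt_inj := by
    intro i j h h'
    have hu' := hu.choose_spec
    by_cases hi : C.comp i = v <;> by_cases hj : C.comp j = v
    · have : C.pt i = C.pt j := by
        rcases eq_or_of_not_stableAt hv (pt_mem hi) (pt_mem hj) (node_mem hu') with h | h | h
        · exact h
        · exact absurd h (by have := C.pt_ne_node i hu.choose (hi ▸ hu'); rwa [hi] at this)
        · exact absurd h (by have := C.pt_ne_node j hu.choose (hj ▸ hu'); rwa [hj] at this)
      exact C.pt_inj _ _ (hi.trans hj.symm) this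
    · simp only [hi, hj, dif_pos, if_true, dif_neg, if_false, not_false_eq_true,
        Subtype.mk.injEq] at h h'
      have := C.pt_ne_node j v (h ▸ hu'.symm)
      rw [← h] at this
      exact absurd h'.symm this
    · simp only [hi, hj, dif_pos, if_true, dif_neg, if_false, not_false_eq_true,
        Subtype.mk.injEq] at h h'
      have := C.pt_ne_node i v (h ▸ hu'.symm)
      rw [h] at this
      exact absurd h' this
    · simp only [hi, hj, dif_neg, if_false, not_false_eq_true, Subtype.mk.injEq] at h h'
      exact C.pt_inj _ _ h h'
  pt_ne_node := by
    rintro i ⟨w, hw⟩ ⟨hne, h⟩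
    have hu' := hu.choose_spec
    by_cases hi : C.comp i = v
    · simp only [hi, dif_pos, if_true] at hne h ⊢
      by_cases h' : C.G.Adj hu.choose w
      · simp only [h', if_true]
        intro h2
        exact hw (C.node_inj _ _ _ hu'.symm h' h2).symm
      · have h3 : hu.choose = w := adj_eq_of_comp hv hi hu' (h.resolve_left h').2
        exact absurd (Subtype.ext h3) hne
    · simp only [hi, dif_neg, if_false, not_false_eq_true] at hne h ⊢
      by_cases h' : C.G.Adj (C.comp i) w
      · simp only [h', if_true]
        exact C.pt_ne_node _ _ h'
      · simp only [h', if_false]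
        exact C.pt_ne_node _ _ (h.resolve_left h').1

theorem special_subset_collapse (C : MarkedCurve n) (v : C.V) (hv : ¬ C.StableAt v)
    (h2 : 2 ≤ (C.special v).encard) (hu : ∃ u, C.G.Adj v u) (w : C.V) (hw : w ≠ v) :
    C.special w ⊆ (C.collapse v hv hu).special ⟨w, hw⟩ := by
  have hu' := hu.choose_spec
  rintro p (⟨x, hx, rfl⟩ | ⟨i, hi, rfl⟩)
  · by_cases hxv : x = v
    · subst hxv
      obtain ⟨q, hq, hqw⟩ : ∃ q ∈ C.special x, q ≠ C.node x w := by
        have h3 : 1 < (C.special x).encard := lt_of_lt_of_le (by norm_num) h2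
        obtain ⟨a, b, ha, hb, hab⟩ := Set.one_lt_encard_iff.1 h3
        by_cases h : a = C.node x w
        · exact ⟨b, hb, fun h' => hab (h.trans h'.symm)⟩
        · exact ⟨a, ha, h⟩
      rcases hq with ⟨y, hy, rfl⟩ | ⟨j, hj, rfl⟩
      · have hyw : y ≠ w := fun h => hqw (h ▸ rfl)
        refine Or.inl ⟨⟨y, hy.ne'⟩, ⟨fun h => hyw (congrArg Subtype.val h).symm,
          Or.inr ⟨hx, hy⟩⟩, ?_⟩
        have : ¬ C.G.Adj w y := fun h => by
          have := C.isTree.dist_ne_of_adj x h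
          rw [SimpleGraph.dist_eq_one_iff_adj.2 hx.symm, SimpleGraph.dist_eq_one_iff_adj.2 hy] at this
          exact this rfl
        simp [collapse, this]
      · refine Or.inr ⟨j, ?_, ?_⟩
        · simpa [collapse, hj] using adj_eq_of_comp hv hj hu' hx.symm
        · have := adj_eq_of_comp hv hj hu' hx.symm
          simp [collapse, hj, this]
    · refine Or.inl ⟨⟨x, hxv⟩, ⟨fun h => hx.ne (congrArg Subtype.val h), Or.inl hx⟩, ?_⟩
      simp [collapse, hx]
  · subst hi
    exact Or.inr ⟨i, by simp [collapse, hw], by simp [collapse, hw]⟩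

theorem collapse_isStable (C : MarkedCurve n) (v : C.V) (hv : ¬ C.StableAt v)
    (h2 : 2 ≤ (C.special v).encard) (hu : ∃ u, C.G.Adj v u) (hs : ∀ w ≠ v, C.StableAt w) :
    (C.collapse v hv hu).IsStable := by
  rintro ⟨w, hw⟩
  exact (hs w hw).trans (Set.encard_le_encard (C.special_subset_collapse v hv h2 hu w hw))

/-- A component with too few distinguished points meets another one if there are at least three
marked points. -/
theorem exists_adj (C : MarkedCurve n) (hn : 3 ≤ n) (v : C.V) (hv : ¬ C.StableAt v) :
    ∃ u, C.G.Adj v u := by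
  by_contra! h
  have hall : ∀ w, w = v := by
    intro w
    by_contra hw
    obtain ⟨p⟩ := C.isTree.connected.preconnected v w
    cases p with
    | nil => exact hw rfl
    | cons h' _ => exact h _ h'
  have hpt : ∀ i j : Fin n, C.pt i = C.pt j → i = j := fun i j hij =>
    C.pt_inj i j ((hall _).trans (hall _).symm) hij
  have hm : ∀ i : Fin n, C.pt i ∈ C.special v := fun i => pt_mem (hall _)
  rcases eq_or_of_not_stableAt hv (hm ⟨0, by omega⟩) (hm ⟨1, by omega⟩) (hm ⟨2, by omega⟩)
    with h | h | h <;> simpa using hpt _ _ h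

theorem erase_stableAt {C : MarkedCurve (n + 1)} (hC : C.IsStable) (i : Fin (n + 1)) (w : C.V)
    (hw : w ≠ C.comp i) : (C.erase i).StableAt w := by
  refine (hC w).trans (Set.encard_le_encard ?_)
  rintro p (h | ⟨j, rfl, rfl⟩)
  · exact Or.inl h
  · obtain ⟨k, rfl⟩ := Fin.exists_succAbove_eq (x := j) (y := i) (fun h => hw (h ▸ rfl))
    exact Or.inr ⟨k, rfl, rfl⟩

theorem two_le_erase {C : MarkedCurve (n + 1)} (hC : C.IsStable) (i : Fin (n + 1)) :
    2 ≤ ((C.erase i).special (C.comp i)).encard := by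
  have h1 : C.special (C.comp i) ⊆ insert (C.pt i) ((C.erase i).special (C.comp i)) := by
    rintro p (h | ⟨j, hj, rfl⟩)
    · exact Or.inr (Or.inl h)
    · by_cases hji : j = i
      · exact Or.inl (by rw [hji])
      · obtain ⟨k, rfl⟩ := Fin.exists_succAbove_eq hji
        exact Or.inr (Or.inr ⟨k, hj, rfl⟩)
  have h2 := ((hC (C.comp i)).trans (Set.encard_le_encard h1)).trans (Set.encard_insert_le _ _)
  have h3 : (2 : ℕ∞) + 1 ≤ ((C.erase i).special (C.comp i)).encard + 1 := by
    simpa [show (2 : ℕ∞) + 1 = 3 by norm_num] using h2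
  exact (ENat.add_le_add_iff_right (by simp)).1 h3

/-- Isomorphic curves have isomorphic erasures. -/
def Iso.erase {C D : MarkedCurve (n + 1)} (φ : Iso C D) (i : Fin (n + 1)) :
    Iso (C.erase i) (D.erase i) where
  e := φ.e
  mob := φ.mob
  node_eq := φ.node_eq
  comp_eq j := φ.comp_eq (i.succAbove j)
  pt_eq j := φ.pt_eq (i.succAbove j)

theorem Iso.collapse {C D : MarkedCurve n} (φ : Iso C D) (v : C.V) (hv : ¬ C.StableAt v)
    (hu : ∃ u, C.G.Adj v u) (v' : D.V) (hvv : v' = φ.e v) (hv' : ¬ D.StableAt v')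
    (hu' : ∃ u, D.G.Adj v' u) :
    Nonempty (Iso (C.collapse v hv hu) (D.collapse v' hv' hu')) := by
  subst hvv
  have hadj : ∀ a b, D.G.Adj (φ.e a) (φ.e b) ↔ C.G.Adj a b := fun a b => φ.e.map_rel_iff
  have hch : ∀ i, C.comp i = v → hu'.choose = φ.e hu.choose := fun i hi =>
    adj_eq_of_comp hv' (i := i) (by rw [φ.comp_eq, hi]) hu'.choose_spec
      ((hadj _ _).2 hu.choose_spec)
  refine ⟨{
    e := ⟨φ.e.toEquiv.subtypeEquiv (fun a => by simp), ?_⟩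
    mob := fun w => φ.mob w.1
    node_eq := ?_
    comp_eq := ?_
    pt_eq := ?_ }⟩
  · rintro ⟨a, ha⟩ ⟨b, hb⟩
    have ha' : φ.e a ≠ φ.e v := fun h => ha (φ.e.injective h)
    have hb' : φ.e b ≠ φ.e v := fun h => hb (φ.e.injective h)
    change (D.G.suppress (φ.e v)).Adj ⟨φ.e a, ha'⟩ ⟨φ.e b, hb'⟩ ↔
      (C.G.suppress v).Adj ⟨a, ha⟩ ⟨b, hb⟩
    simp [SimpleGraph.suppress, hadj]
  · rintro ⟨a, ha⟩ ⟨b, hb⟩ ⟨hne, h⟩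
    classical
    change (if D.G.Adj (φ.e a) (φ.e b) then D.node (φ.e a) (φ.e b) else D.node (φ.e a) (φ.e v)) =
      φ.mob a • (if C.G.Adj a b then C.node a b else C.node a v)
    by_cases hab : C.G.Adj a b
    · simpa [hadj, hab] using φ.node_eq _ _ hab
    · simpa [hadj, hab] using φ.node_eq _ _ (h.resolve_left hab).1
  · intro i
    by_cases hi : C.comp i = v
    · refine Subtype.ext ?_
      simp only [MarkedCurve.collapse, hi, φ.comp_eq, dif_pos]
      exact hch i hi
    · refine Subtype.ext ?_
      simp only [MarkedCurve.collapse, hi, φ.comp_eq, EmbeddingLike.apply_eq_iff_eq, dif_neg,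
        not_false_eq_true]
      rfl
  · intro i
    by_cases hi : C.comp i = v
    · simpa [MarkedCurve.collapse, hi, φ.comp_eq, hch i hi] using
        φ.node_eq _ _ hu.choose_spec.symm
    · simpa [MarkedCurve.collapse, hi, φ.comp_eq] using φ.pt_eq i

end MarkedCurve

/-! ### The spaces `M̄_{0,n}` as sets, and the forgetful maps -/

/-- Stable rational curves with `n` marked points. -/
abbrev StableCurve (n : ℕ) : Type 1 := {C : MarkedCurve n // C.IsStable}

instance StableCurve.setoid (n : ℕ) : Setoid (StableCurve n) where
  r C D := Nonempty (MarkedCurve.Iso C.1 D.1)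
  iseqv := ⟨fun C => ⟨.refl C.1⟩, fun ⟨φ⟩ => ⟨φ.symm⟩, fun ⟨φ⟩ ⟨ψ⟩ => ⟨φ.trans ψ⟩⟩

open Classical in
/-- Forgetting the `i`-th marked point of a stable curve: erase the point marked by `i`, and then
collapse the component that carried it if it is left with only two distinguished points. -/
noncomputable def StableCurve.forget {n : ℕ} (hn : 3 ≤ n) (i : Fin (n + 1))
    (C : StableCurve (n + 1)) : StableCurve n :=
  if h : (C.1.erase i).StableAt (C.1.comp i) then
    ⟨C.1.erase i, fun w => by
      by_cases hw : w = C.1.comp i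
      · exact hw ▸ h
      · exact MarkedCurve.erase_stableAt C.2 i w hw⟩
  else
    ⟨(C.1.erase i).collapse (C.1.comp i) h (MarkedCurve.exists_adj _ hn _ h),
      MarkedCurve.collapse_isStable _ _ _ (MarkedCurve.two_le_erase C.2 i) _
        (MarkedCurve.erase_stableAt C.2 i)⟩

theorem StableCurve.forget_equiv {n : ℕ} (hn : 3 ≤ n) (i : Fin (n + 1))
    (C D : StableCurve (n + 1)) (h : C ≈ D) : C.forget hn i ≈ D.forget hn i := by
  obtain ⟨φ⟩ := h
  have hiff : (D.1.erase i).StableAt (D.1.comp i) ↔ (C.1.erase i).StableAt (C.1.comp i) := by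
    constructor
    · intro h
      have := (φ.symm.erase i).stableAt h
      rwa [show (φ.symm.erase i).e (D.1.comp i) = C.1.comp i from (φ.symm.comp_eq i).symm] at this
    · intro h
      have := (φ.erase i).stableAt h
      rwa [show (φ.erase i).e (C.1.comp i) = D.1.comp i from (φ.comp_eq i).symm] at this
  unfold StableCurve.forget
  by_cases h : (C.1.erase i).StableAt (C.1.comp i)
  · rw [dif_pos h, dif_pos (hiff.2 h)]
    exact ⟨φ.erase i⟩
  · rw [dif_neg h, dif_neg (fun h' => h (hiff.1 h'))]
    exact (φ.erase i).collapse _ h _ _ (φ.comp_eq i) (fun h' => h (hiff.1 h')) _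

/-- The set `M̄_{0,n}`: isomorphism classes of stable rational curves with `n` marked points if
`n ≥ 3`, and, by convention, a point if `n < 3`. -/
def MBar : ℕ → Type 1
  | n + 3 => Quotient (StableCurve.setoid (n + 3))
  | _ => PUnit

/-- The forgetful map `∂ᵢ : M̄_{0,n+1} → M̄_{0,n}`. -/
noncomputable def MBar.forget : ∀ (n : ℕ), Fin (n + 1) → MBar (n + 1) → MBar n
  | n + 3, i => Quotient.map (StableCurve.forget (Nat.le_add_left 3 n) i)
      (StableCurve.forget_equiv (Nat.le_add_left 3 n) i)
  | 0, _ => fun _ => PUnit.unit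
  | 1, _ => fun _ => PUnit.unit
  | 2, _ => fun _ => PUnit.unit

/-- The sequence of sets in which `M̄_{0,n+1}` is the set of `n`-simplices. -/
abbrev MBarSimplex (n : ℕ) : Type 1 := MBar (n + 1)

/-- The face maps on the sequence `MBarSimplex`: these are the forgetful maps. -/
noncomputable abbrev MBarFace (n : ℕ) (i : Fin (n + 2)) : MBarSimplex (n + 1) → MBarSimplex n :=
  MBar.forget (n + 1) i

/-! A component `v` of a stable curve sees each marked point in a direction: the point itself if it
lies on `v`, otherwise the node of `v` that leads to it. This is a map `view v` from the labels to
the projective line. Three distinct labels are seen in distinct directions from exactly one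
component, their median in the tree, so four labels `a`, `b`, `c`, `d` have a cross-ratio `T a b c
d`, taken on the median of `a`, `b`, `c`.

The views determine the curve: adjacency, nodes and positions of the marked points can all be read
off from them (`IsStable.adj_iff`, `IsStable.node_eq`, `IsStable.comp_eq_iff`). As `T a b c` is a
view up to a Möbius transformation, `T` determines the curve up to isomorphism. Forgetting a label
restricts `T` to the other labels (`StableCurve.crossRatios_forget`). The simplicial identities
follow, and so does injectivity, since a value of `T` involves only four labels.

For existence, faces that satisfy the simplicial equations glue to a function `T` on quadruples. The
rule for changing the base triple is then known only when the labels involved miss some label. But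
triples can be changed one label at a time: passing from `x, y, z` to `a, y, z`, tested at `d`,
involves five labels, so six labels suffice (`IsLocalCrossRatioSystem.seenFrom`). Hence the Möbius
classes of the maps `T a b c` behave like components: distinct classes separate no common triple,
and a case of Kőnig's theorem turns this into the axiom `sep` of a stable family. From such a family
the tree is rebuilt (`IsStableFamily.curve`). -/

/-! ### Möbius transformations and cross-ratios -/

open OnePoint in
/-- Three distinct points of the projective line can be moved to `0`, `1`, `∞`. -/
theorem exists_smul_eq_zero_one_infty {p q r : OnePoint ℂ} (hpq : p ≠ q) (hpr : p ≠ r)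
    (hqr : q ≠ r) :
    ∃ g : GL (Fin 2) ℂ, g • p = ((0 : ℂ) : OnePoint ℂ) ∧ g • q = ((1 : ℂ) : OnePoint ℂ) ∧
      g • r = ∞ := by
  have key : ∀ p q : OnePoint ℂ, p ≠ q → p ≠ ∞ → q ≠ ∞ →
      ∃ g : GL (Fin 2) ℂ, g • p = ((0 : ℂ) : OnePoint ℂ) ∧ g • q = ((1 : ℂ) : OnePoint ℂ) ∧
      g • (∞ : OnePoint ℂ) = ∞ := by
    intro p q hpq hp hq
    lift p to ℂ using hp
    lift q to ℂ using hq
    have h : q - p ≠ 0 := fun h => hpq (by rw [sub_eq_zero.1 h])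
    refine ⟨Matrix.GeneralLinearGroup.mkOfDetNeZero !![1, -p; 0, q - p] (by
      simpa [Matrix.det_fin_two] using h), ?_, ?_, ?_⟩
    · simp [smul_some_eq_ite, Matrix.GeneralLinearGroup.mkOfDetNeZero, h]
    · simp [smul_some_eq_ite, Matrix.GeneralLinearGroup.mkOfDetNeZero, h, ← sub_eq_add_neg]
    · simp [smul_infty_eq_ite, Matrix.GeneralLinearGroup.mkOfDetNeZero]
  -- It remains to send `r` to `∞`, by `x ↦ 1 / (x - r)`; `key` then uses the affine map `x ↦ (x -
  -- p) / (q - p)`.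
  obtain ⟨g, hg⟩ : ∃ g : GL (Fin 2) ℂ, g • r = ∞ := by
    cases r using OnePoint.rec with
    | infty => exact ⟨1, one_smul _ _⟩
    | coe r =>
      refine ⟨Matrix.GeneralLinearGroup.mkOfDetNeZero !![0, 1; 1, -r] (by
        simp [Matrix.det_fin_two]), ?_⟩
      simp [smul_some_eq_ite, Matrix.GeneralLinearGroup.mkOfDetNeZero]
  have inj := MulAction.injective (β := OnePoint ℂ) g
  obtain ⟨k, h1, h2, h3⟩ := key (g • p) (g • q) (inj.ne hpq) (hg ▸ inj.ne hpr) (hg ▸ inj.ne hqr)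
  exact ⟨k * g, by rw [mul_smul, h1], by rw [mul_smul, h2], by rw [mul_smul, hg, h3]⟩

open OnePoint in
/-- A Möbius transformation that fixes `0`, `1`, `∞` is trivial. -/
theorem smul_eq_self_of_fixes {g : GL (Fin 2) ℂ}
    (h0 : g • ((0 : ℂ) : OnePoint ℂ) = ((0 : ℂ) : OnePoint ℂ))
    (h1 : g • ((1 : ℂ) : OnePoint ℂ) = ((1 : ℂ) : OnePoint ℂ))
    (h2 : g • (∞ : OnePoint ℂ) = ∞) (x : OnePoint ℂ) : g • x = x := by
  have hc : g 1 0 = 0 := smul_infty_eq_self_iff.1 h2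
  have hd : g 1 1 ≠ 0 := fun h => g.det_ne_zero (by simp [Matrix.det_fin_two, hc, h])
  have hb : g 0 1 = 0 := by
    rw [smul_some_eq_ite] at h0
    simpa [hc, hd] using h0
  have ha : g 0 0 = g 1 1 := by
    rw [smul_some_eq_ite] at h1
    simp only [hc, hb, mul_one, zero_add, hd, if_false, add_zero] at h1
    have := OnePoint.coe_injective h1
    rwa [div_eq_one_iff_eq hd] at this
  cases x using OnePoint.rec with
  | infty => exact h2
  | coe x =>
    rw [smul_some_eq_ite]
    simp [hc, hb, ha, hd, mul_div_cancel_left₀]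

open OnePoint Classical in
/-- The cross-ratio: the image of `x` under the Möbius transformation that sends `p`, `q`, `r` to
`0`, `1`, `∞`. -/
noncomputable def crossRatio (p q r x : OnePoint ℂ) : OnePoint ℂ :=
  if h : ∃ g : GL (Fin 2) ℂ, g • p = ((0 : ℂ) : OnePoint ℂ) ∧ g • q = ((1 : ℂ) : OnePoint ℂ) ∧
      g • r = ∞ then h.choose • x else ∞

/-- Three pairwise distinct elements. -/
def Distinct3 {α : Type*} (a b c : α) : Prop := a ≠ b ∧ a ≠ c ∧ b ≠ c

theorem Distinct3.of_map {α β : Type*} (f : α → β) {a b c : α}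
    (h : Distinct3 (f a) (f b) (f c)) : Distinct3 a b c :=
  ⟨fun e => h.1 (e ▸ rfl), fun e => h.2.1 (e ▸ rfl), fun e => h.2.2 (e ▸ rfl)⟩

theorem Distinct3.map {α β : Type*} {f : α → β} (hf : Function.Injective f) {a b c : α}
    (h : Distinct3 a b c) : Distinct3 (f a) (f b) (f c) :=
  ⟨hf.ne h.1, hf.ne h.2.1, hf.ne h.2.2⟩

theorem distinct3_smul_iff (g : GL (Fin 2) ℂ) {p q r : OnePoint ℂ} :
    Distinct3 (g • p) (g • q) (g • r) ↔ Distinct3 p q r :=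
  ⟨fun h => h.of_map (fun x : OnePoint ℂ => g • x), fun h => h.map (MulAction.injective g)⟩

theorem exists_crossRatio_eq_smul {p q r : OnePoint ℂ} (h : Distinct3 p q r) :
    ∃ g : GL (Fin 2) ℂ, ∀ x, crossRatio p q r x = g • x :=
  ⟨_, fun _ => dif_pos (exists_smul_eq_zero_one_infty h.1 h.2.1 h.2.2)⟩

-- The normalisations chosen before and after `g` differ by a transformation that fixes `0`, `1`,
-- `∞`, so the choice in `crossRatio` does not matter.
open OnePoint in
theorem crossRatio_smul {p q r : OnePoint ℂ} (h : Distinct3 p q r) (g : GL (Fin 2) ℂ)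
    (x : OnePoint ℂ) : crossRatio (g • p) (g • q) (g • r) (g • x) = crossRatio p q r x := by
  have e1 := exists_smul_eq_zero_one_infty h.1 h.2.1 h.2.2
  have h' := (distinct3_smul_iff g).2 h
  have e2 := exists_smul_eq_zero_one_infty h'.1 h'.2.1 h'.2.2
  rw [crossRatio, crossRatio, dif_pos e1, dif_pos e2]
  obtain ⟨a1, a2, a3⟩ := e1.choose_spec
  obtain ⟨b1, b2, b3⟩ := e2.choose_spec
  set k := e1.choose
  set l := e2.choose
  have hk : ∀ y : OnePoint ℂ, k⁻¹ • k • y = y := fun y => inv_smul_smul k y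
  have := smul_eq_self_of_fixes (g := l * g * k⁻¹)
    (by rw [← a1, mul_smul, mul_smul, hk, b1, a1]) (by rw [← a2, mul_smul, mul_smul, hk, b2, a2])
    (by rw [← a3, mul_smul, mul_smul, hk, b3, a3]) (k • x)
  rwa [mul_smul, mul_smul, hk] at this

/-! ### Combinatorics of triples and of paths in trees -/

/-- Kőnig's theorem in a special case: if no three elements are separated by both `f` and `h`,
and `f` and `h` both take three values, then one value of `f` and one value of `h` cover
everything. -/
theorem exists_cover_of_no_common_triple {S α : Type*} {f h : S → α}
    (hf : ∃ a b c, Distinct3 (f a) (f b) (f c)) (hh : ∃ a b c, Distinct3 (h a) (h b) (h c))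
    (hfh : ∀ a b c, Distinct3 (f a) (f b) (f c) → ¬ Distinct3 (h a) (h b) (h c)) :
    ∃ p q, ∀ s, f s = p ∨ h s = q := by
  obtain ⟨x, y, z, hxyz, hq⟩ : ∃ x y z, Distinct3 (f x) (f y) (f z) ∧ h y = h z := by
    obtain ⟨a, b, c, h1⟩ := hf
    have := hfh a b c h1
    unfold Distinct3 at *
    by_cases e1 : h b = h c
    · exact ⟨a, b, c, h1, e1⟩
    by_cases e2 : h a = h c
    · exact ⟨b, a, c, ⟨h1.1.symm, h1.2.2, h1.2.1⟩, e2⟩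
    · exact ⟨c, a, b, ⟨h1.2.1.symm, h1.2.2.symm, h1.1⟩, by grind⟩
  -- Otherwise the triples `s, t, y` and `s, t, z` force `f s`, `f t` to be `f y`, `f z` in some
  -- order. Then `f` separates `s, t, x`, so `h x` is `h s` or `h t`, and `x`, the other one of `s,
  -- t`, and one of `y, z` form a common triple.
  have key : ∀ s t, h s ≠ h y → h t ≠ h y → f s ≠ f t → h s = h t := by
    intro s t hs ht hst
    by_contra hne
    have h1 := hfh s t y
    have h2 := hfh s t z
    have h3 := hfh s t x
    have h4 := hfh x s z
    have h5 := hfh x s y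
    have h6 := hfh x t z
    have h7 := hfh x t y
    unfold Distinct3 at *
    grind
  -- Without a cover, `f` is not constant off the class of `h y`, so `key` makes `h` constant there;
  -- but `h` takes a third value.
  by_contra! hcon
  obtain ⟨s, t, hs, ht, hst⟩ : ∃ s t, h s ≠ h y ∧ h t ≠ h y ∧ f s ≠ f t := by
    obtain ⟨s, -, hs⟩ := hcon (f y) (h y)
    obtain ⟨t, h1, ht⟩ := hcon (f s) (h y)
    exact ⟨s, t, hs, ht, Ne.symm h1⟩
  obtain ⟨u, hu, hu'⟩ : ∃ u, h u ≠ h y ∧ h u ≠ h s := by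
    obtain ⟨a, b, c, h1⟩ := hh
    unfold Distinct3 at h1
    by_cases ha : h a ≠ h y ∧ h a ≠ h s
    · exact ⟨a, ha⟩
    by_cases hb : h b ≠ h y ∧ h b ≠ h s
    · exact ⟨b, hb⟩
    · exact ⟨c, by grind⟩
  have h1 := key s t hs ht hst
  by_cases h2 : f u = f s
  · exact hu' ((key u t hu ht (h2 ▸ hst)).trans h1.symm)
  · exact hu' (key u s hu hs h2)

/-- In a tree, a vertex `v` has at most one neighbour that is nearer to `u` than `v` is. -/
theorem SimpleGraph.IsTree.eq_of_adj_of_dist_lt {V : Type*} {G : SimpleGraph V} (hG : G.IsTree)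
    {u v w w' : V} (hw : G.Adj v w) (hw' : G.Adj v w') (h : G.dist w u < G.dist v u)
    (h' : G.dist w' u < G.dist v u) : w = w' := by
  classical
  have key : ∀ x, G.Adj v x → G.dist x u < G.dist v u →
      ∃ p : G.Walk v u, p.IsPath ∧ p.snd = x := by
    intro x hx hlt
    obtain ⟨p, hp, hlen⟩ := hG.connected.exists_path_of_dist x u
    refine ⟨.cons hx p, ?_, by simp⟩
    rw [SimpleGraph.Walk.cons_isPath_iff]
    refine ⟨hp, fun hv => ?_⟩
    have h1 := SimpleGraph.dist_le (p.dropUntil v hv)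
    have h2 := p.length_dropUntil_le_length hv
    omega
  obtain ⟨p, hp, rfl⟩ := key w hw h
  obtain ⟨p', hp', rfl⟩ := key w' hw' h'
  rw [(hG.existsUnique_path v u).unique hp hp']

theorem SimpleGraph.Connected.exists_adj_dist_add_one {V : Type*} {G : SimpleGraph V}
    (hG : G.Connected) {u v : V} (h : v ≠ u) : ∃ w, G.Adj v w ∧ G.dist w u + 1 = G.dist v u := by
  obtain ⟨p, hp, hlen⟩ := hG.exists_path_of_dist v u
  cases p with
  | nil => exact absurd rfl h
  | @cons _ w _ hw q =>
    refine ⟨w, hw, ?_⟩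
    have h1 := SimpleGraph.dist_le q
    have h2 := hG.dist_triangle (u := v) (v := w) (w := u)
    rw [SimpleGraph.dist_eq_one_iff_adj.2 hw] at h2
    simp at hlen
    omega

/-- Assume that `f` assigns to each vertex `v` of a graph a direction such that, for adjacent `v` and
`w`, either `f v` is the direction from `v` to `w` or `f w` is the direction from `w` to `v`. Then
the same holds for the ends of each path. -/
theorem SimpleGraph.Walk.IsPath.eq_direction {V α : Type*} {G : SimpleGraph V} {node : V → V → α}
    {f : V → α} (hinj : ∀ v w w', G.Adj v w → G.Adj v w' → node v w = node v w' → w = w')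
    (hf : ∀ v w, G.Adj v w → f w ≠ node w v → f v = node v w) {v w : V} {p : G.Walk v w}
    (hp : p.IsPath) (hne : v ≠ w) (h : f v ≠ node v p.snd) : f w = node w p.penultimate := by
  induction p with
  | nil => exact absurd rfl hne
  | @cons v u w hvu q ih =>
    rw [SimpleGraph.Walk.snd_cons] at h
    have h1 := hf u v hvu.symm h
    cases q with
    | nil => simpa using h1
    | @cons _ x _ hux r =>
      rw [SimpleGraph.Walk.cons_isPath_iff] at hp
      rw [SimpleGraph.Walk.penultimate_cons_cons]
      -- `f u` points back to `v`, hence not to the next vertex of the path.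
      refine ih hp.1 ?_ ?_
      · rintro rfl
        have := (SimpleGraph.Walk.cons_isPath_iff _ _).1 hp.1
        exact this.2 r.end_mem_support
      · rw [h1, SimpleGraph.Walk.snd_cons]
        intro h2
        have := hinj u v x hvu.symm hux h2
        subst this
        exact hp.2 (by simp)

/-! ### Stable families -/

/-- A family of maps from a set of labels to the projective line that looks like the family of the
maps that assign to each label the direction in which it is seen from a component of a stable
curve. -/
structure IsStableFamily {V S : Type*} (F : V → S → OnePoint ℂ) : Prop where
  three : ∀ v, ∃ a b c, Distinct3 (F v a) (F v b) (F v c)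
  sep : ∀ v w, v ≠ w → ∃ p q, ∀ s, F v s = p ∨ F w s = q
  median : ∀ a b c, Distinct3 a b c → ∃ v, Distinct3 (F v a) (F v b) (F v c)

namespace IsStableFamily

variable {V S : Type*} {F : V → S → OnePoint ℂ}

theorem exists_ne_ne (hF : IsStableFamily F) (v : V) (p q : OnePoint ℂ) :
    ∃ s, F v s ≠ p ∧ F v s ≠ q := by
  obtain ⟨a, b, c, h⟩ := hF.three v
  by_contra! hcon
  have ha := or_iff_not_imp_left.2 (hcon a)
  have hb := or_iff_not_imp_left.2 (hcon b)
  have hc := or_iff_not_imp_left.2 (hcon c)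
  unfold Distinct3 at h
  grind

/-- If `v ≠ w`, then by `sep` two of the three labels are seen in direction `p` from `v`, or two in
direction `q` from `w`. So the vertex in `median` is unique. -/
theorem eq_of_distinct3 (hF : IsStableFamily F) {v w : V} {a b c : S}
    (hv : Distinct3 (F v a) (F v b) (F v c)) (hw : Distinct3 (F w a) (F w b) (F w c)) : v = w := by
  by_contra hne
  obtain ⟨p, q, h⟩ := hF.sep v w hne
  have ha := h a
  have hb := h b
  have hc := h c
  unfold Distinct3 at hv hw
  grind

end IsStableFamily

/-! ### Views from the components of a curve -/

namespace MarkedCurve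

variable {n : ℕ}

open Classical in
/-- The point of the component `v` through which the marked point `s` is seen from `v`: either the
marked point itself, or the node of `v` in the direction of the component that carries it. -/
noncomputable def view (C : MarkedCurve n) (v : C.V) (s : Fin n) : OnePoint ℂ :=
  if h : ∃ w, C.G.Adj v w ∧ C.G.dist w (C.comp s) < C.G.dist v (C.comp s) then
    C.node v h.choose else C.pt s

variable (C : MarkedCurve n)

theorem view_comp (s : Fin n) : C.view (C.comp s) s = C.pt s :=
  dif_neg (by simp)

theorem view_eq_node {v w : C.V} {s : Fin n} (hvw : C.G.Adj v w)
    (h : C.G.dist w (C.comp s) < C.G.dist v (C.comp s)) : C.view v s = C.node v w := by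
  have e : ∃ w, C.G.Adj v w ∧ C.G.dist w (C.comp s) < C.G.dist v (C.comp s) := ⟨w, hvw, h⟩
  rw [view, dif_pos e, C.isTree.eq_of_adj_of_dist_lt e.choose_spec.1 hvw e.choose_spec.2 h]

theorem exists_view_eq_node {v : C.V} {s : Fin n} (h : C.comp s ≠ v) :
    ∃ w, C.G.Adj v w ∧ C.G.dist w (C.comp s) + 1 = C.G.dist v (C.comp s) ∧
      C.view v s = C.node v w := by
  obtain ⟨w, hw, hd⟩ := C.isTree.connected.exists_adj_dist_add_one h.symm
  exact ⟨w, hw, hd, C.view_eq_node hw (by omega)⟩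

theorem view_eq_node_iff_dist {v w : C.V} {s : Fin n} (hvw : C.G.Adj v w) :
    C.view v s = C.node v w ↔ C.G.dist w (C.comp s) < C.G.dist v (C.comp s) := by
  refine ⟨fun h => ?_, C.view_eq_node hvw⟩
  by_cases hs : C.comp s = v
  · subst hs
    rw [view_comp] at h
    exact absurd h (C.pt_ne_node _ _ hvw)
  · obtain ⟨x, hx, hd, he⟩ := C.exists_view_eq_node hs
    have := C.node_inj _ _ _ hvw hx (h.symm.trans he)
    subst this
    omega

/-- In a tree the ends of an edge have different distances to any vertex, so each label lies on
exactly one side of the edge. -/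
theorem view_eq_node_iff {v w : C.V} (s : Fin n) (hvw : C.G.Adj v w) :
    C.view v s = C.node v w ↔ C.view w s ≠ C.node w v := by
  rw [Ne, C.view_eq_node_iff_dist hvw, C.view_eq_node_iff_dist hvw.symm]
  have := C.isTree.dist_ne_of_adj (C.comp s) hvw
  rw [C.G.dist_comm (u := C.comp s), C.G.dist_comm (u := C.comp s)] at this
  omega

/-- The family `view` is determined by its behaviour at the marked points and at the nodes. -/
theorem view_unique {s : Fin n} {f : C.V → OnePoint ℂ} (h0 : f (C.comp s) = C.pt s)
    (h1 : ∀ v w, C.G.Adj v w → f w ≠ C.node w v → f v = C.node v w) (v : C.V) :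
    f v = C.view v s := by
  by_cases hv : C.comp s = v
  · subst hv
    rw [h0, view_comp]
  obtain ⟨p, hp, -⟩ := C.isTree.existsUnique_path (C.comp s) v
  have hnil : ¬ p.Nil := SimpleGraph.Walk.not_nil_of_ne hv
  have hne := C.pt_ne_node s _ (p.adj_snd hnil)
  rw [hp.eq_direction C.node_inj h1 hv (h0 ▸ hne)]
  exact (hp.eq_direction (f := fun v => C.view v s) C.node_inj
    (fun v w h => (C.view_eq_node_iff s h).2) hv (by simpa only [view_comp] using hne)).symm

theorem view_mem_special (v : C.V) (s : Fin n) : C.view v s ∈ C.special v := by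
  by_cases h : C.comp s = v
  · subst h
    rw [view_comp]
    exact pt_mem rfl
  · obtain ⟨w, hw, -, he⟩ := C.exists_view_eq_node h
    exact he ▸ node_mem hw

variable {C}

theorem IsStable.exists_mem_ne_ne (hC : C.IsStable) (v : C.V) (p q : OnePoint ℂ) :
    ∃ x ∈ C.special v, x ≠ p ∧ x ≠ q := by
  by_contra! h
  have h1 : C.special v ⊆ {p, q} := fun x hx => by
    by_cases hp : x = p
    · exact Or.inl hp
    · exact Or.inr (h x hx hp)
  have h2 := (hC v).trans ((Set.encard_le_encard h1).trans (Set.encard_insert_le _ _))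
  rw [Set.encard_singleton] at h2
  exact absurd h2 (by decide)

/-- Walk through the node away from `v`. By stability each component has a distinguished point other
than the node of entry: a marked point, or a node that leads further away. The tree is finite, so a
marked point is reached. -/
theorem IsStable.exists_view_eq_node_of_adj (hC : C.IsStable) {v w : C.V} (h : C.G.Adj v w) :
    ∃ s, C.view v s = C.node v w := by
  have := C.finite
  have : Nonempty C.V := ⟨v⟩
  obtain ⟨m, hm⟩ := Finite.exists_max (C.G.dist v)
  -- As `m` is farthest from `v`, `k` bounds how far the walk can still go beyond `y`.
  suffices H : ∀ k x y, C.G.Adj x y → C.G.dist x v < C.G.dist y v →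
      C.G.dist v m ≤ C.G.dist y v + k → ∃ s, C.view x s = C.node x y by
    refine H (C.G.dist v m) v w h ?_ (by omega)
    simp [SimpleGraph.dist_eq_one_iff_adj.2 h.symm]
  intro k
  induction k with
  | zero =>
    intro x y hxy hd hk
    obtain ⟨p, hp, hne, -⟩ := hC.exists_mem_ne_ne y (C.node y x) (C.node y x)
    rcases hp with ⟨z, hz, rfl⟩ | ⟨s, rfl, rfl⟩
    · exfalso
      have h1 := hm z
      rw [C.G.dist_comm] at h1
      refine hne (congrArg _ (C.isTree.eq_of_adj_of_dist_lt (u := v) hz hxy.symm ?_ hd))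
      have h2 := C.isTree.dist_ne_of_adj v hz
      rw [C.G.dist_comm, C.G.dist_comm (u := v)] at h2
      omega
    · exact ⟨s, (C.view_eq_node_iff s hxy).2 (by rwa [view_comp])⟩
  | succ k ih =>
    intro x y hxy hd hk
    obtain ⟨p, hp, hne, -⟩ := hC.exists_mem_ne_ne y (C.node y x) (C.node y x)
    rcases hp with ⟨z, hz, rfl⟩ | ⟨s, rfl, rfl⟩
    · have h2 := C.isTree.dist_ne_of_adj v hz
      rw [C.G.dist_comm, C.G.dist_comm (u := v)] at h2
      have h3 : ¬ C.G.dist z v < C.G.dist y v := fun h4 =>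
        hne (congrArg _ (C.isTree.eq_of_adj_of_dist_lt hz hxy.symm h4 hd))
      obtain ⟨s, hs⟩ := ih y z hz (by omega) (by omega)
      exact ⟨s, (C.view_eq_node_iff s hxy).2 (by rwa [hs])⟩
    · exact ⟨s, (C.view_eq_node_iff s hxy).2 (by rwa [view_comp])⟩

theorem IsStable.exists_view_eq (hC : C.IsStable) {v : C.V} {p : OnePoint ℂ}
    (hp : p ∈ C.special v) : ∃ s, C.view v s = p := by
  rcases hp with ⟨w, hw, rfl⟩ | ⟨s, rfl, rfl⟩
  · exact hC.exists_view_eq_node_of_adj hw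
  · exact ⟨s, C.view_comp s⟩

-- The median minimises the sum of the distances to the three carriers: if two labels were seen in
-- the same direction, a step that way would shorten two distances by one and lengthen the third by
-- at most one.
variable (C) in
theorem exists_distinct3_view {a b c : Fin n} (h : Distinct3 a b c) :
    ∃ v, Distinct3 (C.view v a) (C.view v b) (C.view v c) := by
  have := C.finite
  have : Nonempty C.V := C.isTree.connected.nonempty
  obtain ⟨v, hv⟩ := Finite.exists_min fun v =>
    C.G.dist v (C.comp a) + C.G.dist v (C.comp b) + C.G.dist v (C.comp c)
  have key : ∀ a b c, a ≠ b → C.view v a = C.view v b → ∃ w,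
      C.G.dist w (C.comp a) + C.G.dist w (C.comp b) + C.G.dist w (C.comp c) <
      C.G.dist v (C.comp a) + C.G.dist v (C.comp b) + C.G.dist v (C.comp c) := by
    intro a b c hab h
    by_cases ha : C.comp a = v <;> by_cases hb : C.comp b = v
    · refine absurd (C.pt_inj a b (ha.trans hb.symm) ?_) hab
      rw [← view_comp, ← view_comp, ha, hb, h]
    · subst ha
      obtain ⟨w, hw, -, he⟩ := C.exists_view_eq_node hb
      rw [view_comp] at h
      exact absurd (h.trans he) (C.pt_ne_node a w hw)
    · subst hb
      obtain ⟨w, hw, -, he⟩ := C.exists_view_eq_node ha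
      rw [view_comp] at h
      exact absurd (h.symm.trans he) (C.pt_ne_node b w hw)
    · obtain ⟨w, hw, hd, he⟩ := C.exists_view_eq_node ha
      obtain ⟨w', hw', hd', he'⟩ := C.exists_view_eq_node hb
      have := C.node_inj _ _ _ hw hw' (he.symm.trans (h.trans he'))
      subst this
      refine ⟨w, ?_⟩
      have := C.isTree.connected.dist_triangle (u := w) (v := v) (w := C.comp c)
      rw [SimpleGraph.dist_eq_one_iff_adj.2 hw.symm] at this
      omega
  refine ⟨v, fun e => ?_, fun e => ?_, fun e => ?_⟩
  · obtain ⟨w, hw⟩ := key a b c h.1 e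
    have := hv w
    omega
  · obtain ⟨w, hw⟩ := key a c b h.2.1 e
    have := hv w
    omega
  · obtain ⟨w, hw⟩ := key b c a h.2.2 e
    have := hv w
    omega

theorem IsStable.isStableFamily (hC : C.IsStable) : IsStableFamily C.view where
  three v := by
    obtain ⟨p, hp, -, -⟩ := hC.exists_mem_ne_ne v (C.node v v) (C.node v v)
    obtain ⟨q, hq, hqp, -⟩ := hC.exists_mem_ne_ne v p p
    obtain ⟨r, hr, hrp, hrq⟩ := hC.exists_mem_ne_ne v p q
    obtain ⟨a, rfl⟩ := hC.exists_view_eq hp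
    obtain ⟨b, rfl⟩ := hC.exists_view_eq hq
    obtain ⟨c, rfl⟩ := hC.exists_view_eq hr
    exact ⟨a, b, c, hqp.symm, hrp.symm, hrq.symm⟩
  sep v w h := by
    obtain ⟨p, hp, -⟩ := C.isTree.existsUnique_path v w
    -- The two directions are those along the path between `v` and `w`: a label that `v` does not
    -- see along it lies behind `v` for `w`.
    refine ⟨C.node v p.snd, C.node w p.penultimate, fun s => or_iff_not_imp_left.2 fun hs => ?_⟩
    exact hp.eq_direction (f := fun v => C.view v s) C.node_inj
      (fun v w h => (C.view_eq_node_iff s h).2) h hs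
  median _ _ _ h := C.exists_distinct3_view h

/-- If another component `u` comes next on the path from `v` to `w`, stability gives a label that
`u` sees off the path. Both `v` and `w` see it along the path, that is, in the directions `p` and
`q`, which the condition excludes. -/
theorem IsStable.adj_iff (hC : C.IsStable) {v w : C.V} :
    C.G.Adj v w ↔ ∃ p q, ∀ s, C.view v s = p ↔ C.view w s ≠ q := by
  refine ⟨fun h => ⟨_, _, fun s => C.view_eq_node_iff s h⟩, ?_⟩
  rintro ⟨p, q, h⟩
  have hF := hC.isStableFamily
  have hne : v ≠ w := by
    rintro rfl
    obtain ⟨s, h1, h2⟩ := hF.exists_ne_ne v p q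
    exact h1 ((h s).2 h2)
  obtain ⟨r, hr, -⟩ := C.isTree.existsUnique_path v w
  cases r with
  | nil => exact absurd rfl hne
  | @cons _ u _ hvu r =>
    by_cases huw : u = w
    · exact huw ▸ hvu
    exfalso
    rw [SimpleGraph.Walk.cons_isPath_iff] at hr
    have dir : ∀ s, C.view v s ≠ C.node v u → C.view w s = C.node w r.penultimate := by
      intro s hs
      refine hr.1.eq_direction (f := fun v => C.view v s) C.node_inj
        (fun v w h => (C.view_eq_node_iff s h).2) huw ?_
      have h1 := (C.view_eq_node_iff s hvu.symm).2 hs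
      simp only [h1]
      intro h2
      have := C.node_inj _ _ _ hvu.symm (r.adj_snd (SimpleGraph.Walk.not_nil_of_ne huw)) h2
      exact hr.2 (this ▸ r.getVert_mem_support 1)
    have hp : C.node v u = p := by
      by_contra hpn
      obtain ⟨s, h1, h2⟩ := hF.exists_ne_ne w q (C.node w r.penultimate)
      have h3 := (h s).2 h1
      exact h2 (dir s (fun h4 => hpn (h4.symm.trans h3)))
    have hq : C.node w r.penultimate = q := by
      obtain ⟨s, h1, -⟩ := hF.exists_ne_ne v p p
      rw [← dir s (hp ▸ h1)]
      by_contra h2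
      exact h1 ((h s).2 h2)
    obtain ⟨s, h1, h2⟩ := hF.exists_ne_ne u (C.node u v) (C.node u r.snd)
    have h3 : C.view v s = p := by
      rw [← hp]; exact (C.view_eq_node_iff s hvu).2 h1
    refine (h s).1 h3 ?_
    rw [← hq]
    exact hr.1.eq_direction (f := fun v => C.view v s) C.node_inj
      (fun v w h => (C.view_eq_node_iff s h).2) huw h2

theorem IsStable.node_eq (hC : C.IsStable) {v w : C.V} (h : C.G.Adj v w) {p q : OnePoint ℂ}
    (hpq : ∀ s, C.view v s = p ↔ C.view w s ≠ q) : C.node v w = p := by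
  by_contra hne
  have hF := hC.isStableFamily
  obtain ⟨s, h1, h2⟩ := hF.exists_ne_ne w q (C.node w v)
  exact hne (((C.view_eq_node_iff s h).2 h2).symm.trans ((hpq s).2 h1))

/-- Through a node at least two labels are seen, because the component behind it has at least two
further directions. -/
theorem IsStable.comp_eq_iff (hC : C.IsStable) {s : Fin n} {v : C.V} :
    C.comp s = v ↔ ∀ t, C.view v t = C.view v s → t = s := by
  constructor
  · rintro rfl t ht
    rw [view_comp] at ht
    by_cases h : C.comp t = C.comp s
    · exact C.pt_inj _ _ h (by rw [← ht, ← h, view_comp])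
    · obtain ⟨w, hw, -, he⟩ := C.exists_view_eq_node h
      exact absurd (ht.symm.trans he) (C.pt_ne_node _ _ hw)
  · intro h
    by_contra hs
    obtain ⟨w, hw, -, he⟩ := C.exists_view_eq_node hs
    obtain ⟨t, ht, hts⟩ := hC.isStableFamily.exists_ne_ne w (C.node w v) (C.view w s)
    exact hts (congrArg _ (h t (((C.view_eq_node_iff t hw).2 ht).trans he.symm)))

end MarkedCurve

/-! ### Cross-ratios of a curve and the forgetful maps -/

namespace MarkedCurve

variable {n : ℕ}

/-- By `view_unique` only marked points and edges need a check. On a new edge `a`–`b` that replaces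
`a`–`v`–`b`, the nodes of `v` towards `a` and `b` differ, so a label on the side of `b` is seen from
`a` through `v`. -/
theorem view_collapse (C : MarkedCurve n) (v : C.V) (hv : ¬ C.StableAt v)
    (hu : ∃ u, C.G.Adj v u) (w : {w // w ≠ v}) (s : Fin n) :
    (C.collapse v hv hu).view w s = C.view w s := by
  classical
  refine ((C.collapse v hv hu).view_unique (f := fun w => C.view w.1 s) ?_ ?_ w).symm
  · by_cases hs : C.comp s = v
    · have h1 := hu.choose_spec
      have h2 : C.view hu.choose s = C.node hu.choose v := by
        refine (C.view_eq_node_iff s h1.symm).2 ?_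
        subst hs
        rw [view_comp]
        exact C.pt_ne_node _ _ h1
      simpa [collapse, hs] using h2
    · simpa [collapse, hs] using C.view_comp s
  · rintro ⟨a, ha⟩ ⟨b, hb⟩ ⟨hne, hab⟩ h
    have hne' : a ≠ b := fun e => hne (Subtype.ext e)
    by_cases h1 : C.G.Adj a b
    · simp only [collapse, h1, h1.symm, if_true] at h ⊢
      exact (C.view_eq_node_iff s h1).2 h
    · have h2 := hab.resolve_left h1
      simp only at h2
      simp only [collapse, h1, mt C.G.adj_symm h1, if_false] at h ⊢
      refine (C.view_eq_node_iff s h2.1).2 ?_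
      rw [(C.view_eq_node_iff s h2.2).2 h]
      exact fun e => hne' (C.node_inj _ _ _ h2.2 h2.1.symm e).symm

theorem Iso.view_eq {C D : MarkedCurve n} (φ : Iso C D) (v : C.V) (s : Fin n) :
    D.view (φ.e v) s = φ.mob v • C.view v s := by
  have h := C.view_unique (f := fun v => (φ.mob v)⁻¹ • D.view (φ.e v) s) (s := s) ?_ ?_ v
  · rw [← h, smul_inv_smul]
  · simp only [← φ.comp_eq, view_comp, φ.pt_eq, inv_smul_smul]
  · intro v w h h1
    have h2 : D.G.Adj (φ.e v) (φ.e w) := φ.e.map_rel_iff.2 h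
    rw [inv_smul_eq_iff, ← φ.node_eq _ _ h]
    refine (D.view_eq_node_iff s h2).2 fun h3 => h1 ?_
    rw [h3, φ.node_eq _ _ h.symm, inv_smul_smul]

open Classical in
/-- The cross-ratio of four marked points, seen from the component that separates the first three
of them. -/
noncomputable def crossRatios (C : MarkedCurve n) (a b c d : Fin n) : OnePoint ℂ :=
  if h : Distinct3 a b c then
    crossRatio (C.view (C.exists_distinct3_view h).choose a)
      (C.view (C.exists_distinct3_view h).choose b) (C.view (C.exists_distinct3_view h).choose c)
      (C.view (C.exists_distinct3_view h).choose d)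
  else OnePoint.infty

/-- The default value is the same for all curves, so curves can be compared by equality of functions
on all quadruples. -/
theorem crossRatios_of_not (C : MarkedCurve n) {a b c : Fin n} (h : ¬ Distinct3 a b c)
    (d : Fin n) : C.crossRatios a b c d = OnePoint.infty :=
  dif_neg h

theorem IsStable.crossRatios_eq {C : MarkedCurve n} (hC : C.IsStable) {v : C.V} {a b c : Fin n}
    (h : Distinct3 (C.view v a) (C.view v b) (C.view v c)) (d : Fin n) :
    C.crossRatios a b c d = crossRatio (C.view v a) (C.view v b) (C.view v c) (C.view v d) := by
  have h1 := h.of_map (C.view v)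
  rw [crossRatios, dif_pos h1,
    hC.isStableFamily.eq_of_distinct3 (C.exists_distinct3_view h1).choose_spec h]

theorem Iso.crossRatios_eq {C D : MarkedCurve n} (φ : Iso C D) (hC : C.IsStable) :
    D.crossRatios = C.crossRatios := by
  funext a b c d
  by_cases h : Distinct3 a b c
  · obtain ⟨v, hv⟩ := C.exists_distinct3_view h
    have hv' : Distinct3 (D.view (φ.e v) a) (D.view (φ.e v) b) (D.view (φ.e v) c) := by
      simp only [φ.view_eq]
      exact (distinct3_smul_iff _).2 hv
    rw [hC.crossRatios_eq hv, (φ.isStable hC).crossRatios_eq hv']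
    simp only [φ.view_eq]
    exact crossRatio_smul hv _ _
  · rw [crossRatios_of_not _ h, crossRatios_of_not _ h]

/-- Components with the same view up to a Möbius transformation. -/
theorem exists_view_eq_smul {C D : MarkedCurve n} (hC : C.IsStable) (hD : D.IsStable)
    (h : C.crossRatios = D.crossRatios) (v : C.V) :
    ∃ w : D.V, ∃ g : GL (Fin 2) ℂ, ∀ s, D.view w s = g • C.view v s := by
  obtain ⟨a, b, c, hv⟩ := hC.isStableFamily.three v
  obtain ⟨w, hw⟩ := D.exists_distinct3_view (hv.of_map (C.view v))
  obtain ⟨g, hg⟩ := exists_crossRatio_eq_smul hv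
  obtain ⟨k, hk⟩ := exists_crossRatio_eq_smul hw
  refine ⟨w, k⁻¹ * g, fun s => ?_⟩
  rw [mul_smul, ← hg, ← hC.crossRatios_eq hv, h, hD.crossRatios_eq hw, hk, inv_smul_smul]

theorem eq_of_view_eq_smul {C : MarkedCurve n} (hC : C.IsStable) {v w : C.V} {g : GL (Fin 2) ℂ}
    (h : ∀ s, C.view w s = g • C.view v s) : v = w := by
  obtain ⟨a, b, c, hv⟩ := hC.isStableFamily.three v
  refine hC.isStableFamily.eq_of_distinct3 hv (w := w) ?_
  simp only [h]
  exact (distinct3_smul_iff g).2 hv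

/-- A stable curve is determined by its cross-ratios up to isomorphism. -/
theorem nonempty_iso_of_crossRatios_eq {C D : MarkedCurve n} (hC : C.IsStable) (hD : D.IsStable)
    (h : C.crossRatios = D.crossRatios) : Nonempty (Iso C D) := by
  choose e m he using exists_view_eq_smul hC hD h
  choose e' m' he' using exists_view_eq_smul hD hC h.symm
  have left : ∀ v, e' (e v) = v := fun v =>
    (eq_of_view_eq_smul hC (g := m' (e v) * m v) fun s => by rw [he', he, mul_smul]).symm
  have right : ∀ v, e (e' v) = v := fun v =>
    (eq_of_view_eq_smul hD (g := m (e' v) * m' v) fun s => by rw [he, he', mul_smul]).symm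
  -- The criteria for adjacency, nodes and marked points speak only of views, so the transformations
  -- `m` carry them from `C` to `D`.
  have tr : ∀ {v w : C.V} {p q : OnePoint ℂ}, (∀ s, C.view v s = p ↔ C.view w s ≠ q) →
      ∀ s, D.view (e v) s = m v • p ↔ D.view (e w) s ≠ m w • q := by
    intro v w p q h s
    rw [he, he, Ne, smul_left_cancel_iff, smul_left_cancel_iff]
    exact h s
  refine ⟨⟨⟨⟨e, e', left, right⟩, ?_⟩, m, ?_, ?_, ?_⟩⟩
  · intro v w
    change D.G.Adj (e v) (e w) ↔ C.G.Adj v w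
    rw [hD.adj_iff, hC.adj_iff]
    constructor
    · rintro ⟨p, q, h⟩
      refine ⟨(m v)⁻¹ • p, (m w)⁻¹ • q, fun s => ?_⟩
      rw [Ne, eq_inv_smul_iff, eq_inv_smul_iff, ← he, ← he]
      exact h s
    · rintro ⟨p, q, h⟩
      exact ⟨_, _, tr h⟩
  · intro v w hvw
    have h1 := tr fun s => C.view_eq_node_iff s hvw
    exact hD.node_eq (hD.adj_iff.2 ⟨_, _, h1⟩) h1
  · intro s
    change D.comp s = e (C.comp s)
    rw [hD.comp_eq_iff]
    intro t ht
    rw [he, he, smul_left_cancel_iff] at ht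
    exact hC.comp_eq_iff.1 rfl t ht
  · intro s
    have : D.comp s = e (C.comp s) := by
      rw [hD.comp_eq_iff]
      intro t ht
      rw [he, he, smul_left_cancel_iff] at ht
      exact hC.comp_eq_iff.1 rfl t ht
    rw [← view_comp, this, he, view_comp]

theorem stableAt_of_distinct3 {C : MarkedCurve n} {v : C.V} {a b c : Fin n}
    (h : Distinct3 (C.view v a) (C.view v b) (C.view v c)) : C.StableAt v := by
  by_contra hv
  unfold Distinct3 at h
  have := eq_or_of_not_stableAt hv (C.view_mem_special v a) (C.view_mem_special v b)
    (C.view_mem_special v c)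
  tauto

end MarkedCurve

/-- Erasing a label leaves the other views unchanged by definition. The component that separates the
first three labels stays stable, so it is not collapsed, and `view_collapse` applies to it. -/
theorem StableCurve.crossRatios_forget {n : ℕ} (hn : 3 ≤ n) (i : Fin (n + 1))
    (C : StableCurve (n + 1)) (a b c d : Fin n) :
    (C.forget hn i).1.crossRatios a b c d =
      C.1.crossRatios (i.succAbove a) (i.succAbove b) (i.succAbove c) (i.succAbove d) := by
  by_cases habc : Distinct3 a b c
  · obtain ⟨v, hv⟩ := C.1.exists_distinct3_view (habc.map (Fin.succAbove_right_injective (p := i)))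
    rw [C.2.crossRatios_eq hv]
    have hs := (C.forget hn i).2
    by_cases h : (C.1.erase i).StableAt (C.1.comp i)
    · rw [StableCurve.forget, dif_pos h] at hs ⊢
      exact hs.crossRatios_eq hv d
    · rw [StableCurve.forget, dif_neg h] at hs ⊢
      have hvi : v ≠ C.1.comp i := by
        rintro rfl
        exact h (MarkedCurve.stableAt_of_distinct3 (C := C.1.erase i) hv)
      have key := fun s => MarkedCurve.view_collapse (C.1.erase i) (C.1.comp i) h
        (MarkedCurve.exists_adj _ hn _ h) ⟨v, hvi⟩ s
      have := hs.crossRatios_eq (v := ⟨v, hvi⟩) (a := a) (b := b) (c := c)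
        (by rw [key, key, key]; exact hv) d
      rw [this, key, key, key, key]
      rfl
  · rw [MarkedCurve.crossRatios_of_not _ habc, MarkedCurve.crossRatios_of_not]
    exact fun h => habc (h.of_map i.succAbove)

/-- The properties of the system of the cross-ratios of a stable curve with set of marked points
`S`: from the position of all points relative to three points `a`, `b`, `c`, one knows the position
relative to three points `x`, `y`, `z` that are separated by the component that separates `a`, `b`,
`c`. -/
structure IsCrossRatioSystem {S : Type*} (T : S → S → S → S → OnePoint ℂ) : Prop where
  junk : ∀ a b c d, ¬ Distinct3 a b c → T a b c d = OnePoint.infty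
  distinct3 : ∀ a b c, Distinct3 a b c → Distinct3 (T a b c a) (T a b c b) (T a b c c)
  change : ∀ a b c x y z d, Distinct3 a b c → Distinct3 (T a b c x) (T a b c y) (T a b c z) →
    T x y z d = crossRatio (T a b c x) (T a b c y) (T a b c z) (T a b c d)

theorem MarkedCurve.IsStable.isCrossRatioSystem {n : ℕ} {C : MarkedCurve n} (hC : C.IsStable) :
    IsCrossRatioSystem C.crossRatios := by
  have key : ∀ a b c, Distinct3 a b c → ∃ v, ∃ g : GL (Fin 2) ℂ,
      Distinct3 (C.view v a) (C.view v b) (C.view v c) ∧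
        ∀ d, C.crossRatios a b c d = g • C.view v d := by
    intro a b c h
    obtain ⟨v, hv⟩ := C.exists_distinct3_view h
    obtain ⟨g, hg⟩ := exists_crossRatio_eq_smul hv
    exact ⟨v, g, hv, fun d => by rw [hC.crossRatios_eq hv, hg]⟩
  refine ⟨fun a b c d h => C.crossRatios_of_not h d, fun a b c h => ?_, fun a b c x y z d h h' => ?_⟩
  · obtain ⟨v, g, hv, hg⟩ := key a b c h
    simp only [hg]
    exact (distinct3_smul_iff g).2 hv
  · obtain ⟨v, g, -, hg⟩ := key a b c h
    simp only [hg] at h' ⊢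
    have h1 := (distinct3_smul_iff g).1 h'
    rw [crossRatio_smul h1, hC.crossRatios_eq h1]

/-! ### The curve of a stable family -/

namespace IsStableFamily

variable {V S : Type} {F : V → S → OnePoint ℂ}

/-- The graph in which `v` and `w` are adjacent if they divide the labels into those seen from `v`
in one direction and those seen from `w` in one direction. -/
def graph (hF : IsStableFamily F) : SimpleGraph V where
  Adj v w := ∃ p q, ∀ s, F v s = p ↔ F w s ≠ q
  symm := ⟨fun _ _ ⟨p, q, h⟩ => ⟨q, p, fun s => by rw [Ne, h s, not_not]⟩⟩
  loopless := ⟨fun v ⟨p, q, h⟩ => by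
    obtain ⟨s, h1, h2⟩ := hF.exists_ne_ne v p q
    exact h1 ((h s).2 h2)⟩

open Classical in
/-- The direction in which `w` is seen from an adjacent vertex `v`. -/
noncomputable def node (hF : IsStableFamily F) (v w : V) : OnePoint ℂ :=
  if h : hF.graph.Adj v w then h.choose else OnePoint.infty

variable (hF : IsStableFamily F)

/-- The direction is well defined: given two candidates, some label is seen from `w` in neither `q`
nor `q'`, and `v` sees it in both candidate directions. -/
theorem node_eq {v w : V} {p q : OnePoint ℂ} (h : ∀ s, F v s = p ↔ F w s ≠ q) :
    hF.node v w = p := by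
  have hadj : hF.graph.Adj v w := ⟨p, q, h⟩
  rw [node, dif_pos hadj]
  obtain ⟨q', h'⟩ := hadj.choose_spec
  obtain ⟨s, h1, h2⟩ := hF.exists_ne_ne w q q'
  rw [← (h s).2 h1, (h' s).2 h2]

theorem eq_node_iff {v w : V} (h : hF.graph.Adj v w) (s : S) :
    F v s = hF.node v w ↔ F w s ≠ hF.node w v := by
  obtain ⟨p, q, h⟩ := h
  rw [hF.node_eq h, hF.node_eq (v := w) (w := v) (p := q) (q := p)
    (fun s => by rw [Ne, h s, not_not])]
  exact h s

/-- Otherwise `w` and `w'` see the same labels in the direction of `v`, and each sees the remaining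
ones in at least two directions. No pair as in `sep` covers both groups. -/
theorem node_inj {v w w' : V} (h : hF.graph.Adj v w) (h' : hF.graph.Adj v w')
    (e : hF.node v w = hF.node v w') : w = w' := by
  by_contra hne
  obtain ⟨x, y, hxy⟩ := hF.sep w w' hne
  have h1 := hF.eq_node_iff h
  have h2 := hF.eq_node_iff h'
  rw [← e] at h2
  by_cases hx : x = hF.node w v
  · obtain ⟨s, hs, hs'⟩ := hF.exists_ne_ne w' (hF.node w' v) y
    exact (h1 s).1 ((h2 s).2 hs) (hx ▸ (hxy s).resolve_right hs')
  · obtain ⟨s, hs, hs'⟩ := hF.exists_ne_ne w (hF.node w v) x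
    obtain ⟨t, ht, -⟩ := hF.exists_ne_ne v (hF.node v w) (hF.node v w)
    have h3 := (hxy s).resolve_left hs'
    have h4 : F w t = hF.node w v := not_not.1 (mt (h1 t).2 ht)
    have h5 : F w' t = hF.node w' v := not_not.1 (mt (h2 t).2 ht)
    have h6 := (hxy t).resolve_left (h4 ▸ Ne.symm hx)
    exact (h2 s).1 ((h1 s).2 hs) (h3.trans (h6.symm.trans h5))

/-- Take a label seen from `v` through neither of its neighbours on the cycle. Followed around the
cycle by `eq_direction`, it would have to be seen through the last neighbour. -/
theorem isAcyclic : hF.graph.IsAcyclic := by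
  intro v c hc
  cases c with
  | nil => exact hc.ne_nil rfl
  | @cons _ w _ hvw p =>
    have hp := (SimpleGraph.Walk.cons_isCycle_iff _ _).1 hc
    have hne : w ≠ v := hvw.ne'
    have hsnd : p.snd ≠ v := by
      intro e
      cases p with
      | nil => exact hne rfl
      | @cons _ x _ hwx q =>
        simp only [SimpleGraph.Walk.snd_cons] at e
        subst e
        exact hp.2 (by simp [Sym2.eq_swap])
    obtain ⟨s, h1, h2⟩ := hF.exists_ne_ne v (hF.node v w) (hF.node v p.penultimate)
    refine h2 (hp.1.eq_direction (f := fun v => F v s) (fun _ _ _ => hF.node_inj)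
      (fun v w h => (hF.eq_node_iff h s).2) hne ?_)
    simp only [(hF.eq_node_iff hvw.symm s).2 h1]
    exact fun e => hsnd (hF.node_inj hvw.symm
      (p.adj_snd (SimpleGraph.Walk.not_nil_of_ne hne)) e).symm

/-- The vertex that separates two labels from a third one that lies in another direction from `v`. -/
theorem exists_between (hF : IsStableFamily F) {v : V} {a b c : S} (hab : a ≠ b) (h : F v a = F v b)
    (hc : F v c ≠ F v a) : ∃ u, u ≠ v ∧ Distinct3 (F u a) (F u b) (F u c) ∧
      ∀ s, F u s ≠ F u c → F v s = F v a := by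
  obtain ⟨u, hu⟩ := hF.median a b c ⟨hab, fun e => hc (e ▸ rfl), fun e => hc (e ▸ h.symm)⟩
  have huv : u ≠ v := by
    rintro rfl
    exact hu.1 h
  obtain ⟨p, q, hpq⟩ := hF.sep v u huv.symm
  have ha := hpq a
  have hb := hpq b
  have hp : F v a = p := by
    by_contra hne
    exact hu.1 ((ha.resolve_left hne).trans (hb.resolve_left (h ▸ hne)).symm)
  have hq : F u c = q := (hpq c).resolve_left (hp ▸ hc)
  exact ⟨u, huv, hu, fun s hs => ((hpq s).resolve_right (hq ▸ hs)).trans hp.symm⟩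

/-- Induction on the number of labels in the overlap `F v = p`, `F w = q`. If it is empty, `v` and
`w` are adjacent. Otherwise take `s` in it, `a` off the class `p` of `v`, and `b` off the class `q`
of `w`: the vertex that separates `s, a, b` lies between `v` and `w` and has a smaller overlap with
each. -/
theorem preconnected (hF : IsStableFamily F) [Finite S] : hF.graph.Preconnected := by
  suffices H : ∀ k v w p q, (∀ s, F v s = p ∨ F w s = q) → {s | F v s = p ∧ F w s = q}.ncard = k →
      hF.graph.Reachable v w by
    intro v w
    by_cases h : v = w
    · exact h ▸ .refl _
    · obtain ⟨p, q, h⟩ := hF.sep v w h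
      exact H _ v w p q h rfl
  intro k
  induction k using Nat.strong_induction_on with
  | _ k ih =>
  intro v w p q hpq hk
  by_cases hadj : hF.graph.Adj v w
  · exact hadj.reachable
  obtain ⟨s, hs, hs'⟩ : ∃ s, F v s = p ∧ F w s = q := by
    by_contra! hcon
    exact hadj ⟨p, q, fun s => ⟨hcon s, (hpq s).resolve_right⟩⟩
  obtain ⟨a, ha, -⟩ := hF.exists_ne_ne v p p
  obtain ⟨b, hb, -⟩ := hF.exists_ne_ne w q q
  have ha' := (hpq a).resolve_left ha
  have hb' := (hpq b).resolve_right hb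
  obtain ⟨u, -, hu, huv⟩ := hF.exists_between (v := v) (a := s) (b := b) (c := a)
    (fun e => hb (e ▸ hs')) (hs.trans hb'.symm) (hs ▸ ha)
  obtain ⟨u', -, hu', huw⟩ := hF.exists_between (v := w) (a := s) (b := a) (c := b)
    (fun e => ha (e ▸ hs)) (hs'.trans ha'.symm) (hs' ▸ hb)
  obtain rfl : u' = u := hF.eq_of_distinct3 hu' ⟨hu.2.1, hu.1, hu.2.2.symm⟩
  rw [hs] at huv
  rw [hs'] at huw
  have hvu : hF.graph.Reachable v u' := by
    refine ih _ ?_ v u' p (F u' a) (fun t => or_iff_not_imp_right.2 (huv t)) rfl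
    rw [← hk]
    refine Set.ncard_lt_ncard ⟨?_, fun h => ?_⟩ (Set.toFinite _)
    · rintro t ⟨h1, h2⟩
      exact ⟨h1, huw t (by rw [h2]; exact hu.2.2.symm)⟩
    · exact hu.2.1 (h ⟨hs, hs'⟩ : _ ∧ _).2
  have huw' : hF.graph.Reachable u' w := by
    refine ih _ ?_ u' w (F u' b) q (fun t => or_iff_not_imp_left.2 (huw t)) rfl
    rw [← hk]
    refine Set.ncard_lt_ncard ⟨?_, fun h => ?_⟩ (Set.toFinite _)
    · rintro t ⟨h1, h2⟩
      exact ⟨huv t (by rw [h1]; exact hu.2.2), h2⟩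
    · exact hu.1 (h ⟨hs, hs'⟩ : _ ∧ _).1
  exact hvu.trans huw'

/-- Choose `v` so that the fewest labels share the direction of `s`. If another label did, a vertex
as in `exists_between` would see `s` in smaller company. -/
theorem exists_comp (hF : IsStableFamily F) [Finite S] [Nonempty V] [Finite V] (s : S) :
    ∃ v, ∀ t, F v t = F v s → t = s := by
  obtain ⟨v, hv⟩ := Finite.exists_min fun v => {t | F v t = F v s}.ncard
  refine ⟨v, fun t ht => ?_⟩
  by_contra hne
  obtain ⟨c, hc, -⟩ := hF.exists_ne_ne v (F v s) (F v s)
  obtain ⟨u, -, hu, huv⟩ := hF.exists_between (Ne.symm hne) ht.symm hc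
  refine absurd (hv u) (not_le.2 (Set.ncard_lt_ncard ⟨?_, fun h => ?_⟩ (Set.toFinite _)))
  · intro x hx
    exact huv x (by rw [show F u x = F u s from hx]; exact hu.2.1)
  · exact hu.1.symm (h ht)

/-- The curve that belongs to a stable family. -/
noncomputable def curve {n : ℕ} {F : V → Fin n → OnePoint ℂ} (hF : IsStableFamily F) [Nonempty V]
    [Finite V] : MarkedCurve n where
  V := V
  finite := inferInstance
  G := hF.graph
  isTree := ⟨⟨hF.preconnected⟩, hF.isAcyclic⟩
  node := hF.node
  comp s := (hF.exists_comp s).choose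
  pt s := F (hF.exists_comp s).choose s
  node_inj _ _ _ := hF.node_inj
  pt_inj i j h h' := by
    rw [h] at h'
    exact (hF.exists_comp j).choose_spec i h'
  pt_ne_node s w hw h := by
    have h1 := (hF.exists_comp s).choose_spec
    obtain ⟨t, h2, h3⟩ := hF.exists_ne_ne w (hF.node w (hF.exists_comp s).choose) (F w s)
    exact h3 (by rw [h1 t (((hF.eq_node_iff hw t).2 h2).trans h.symm)])

theorem view_curve {n : ℕ} {F : V → Fin n → OnePoint ℂ} (hF : IsStableFamily F) [Nonempty V]
    [Finite V] (v : V) (s : Fin n) : hF.curve.view v s = F v s :=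
  (hF.curve.view_unique (f := fun v => F v s) rfl (fun _ _ h => (hF.eq_node_iff h s).2) v).symm

theorem curve_isStable {n : ℕ} {F : V → Fin n → OnePoint ℂ} (hF : IsStableFamily F) [Nonempty V]
    [Finite V] : hF.curve.IsStable := by
  intro v
  obtain ⟨a, b, c, h⟩ := hF.three v
  refine MarkedCurve.stableAt_of_distinct3 (a := a) (b := b) (c := c) ?_
  have key := hF.view_curve v
  rwa [key, key, key]

end IsStableFamily

/-! ### Local systems of cross-ratios come from curves -/

/-- Up to a Möbius transformation, `f` is the system of positions relative to `x`, `y`, `z`. -/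
def SeenFrom {S : Type*} (T : S → S → S → S → OnePoint ℂ) (f : S → OnePoint ℂ) (x y z : S) : Prop :=
  Distinct3 (f x) (f y) (f z) ∧ ∃ g : GL (Fin 2) ℂ, ∀ s, f s = g • T x y z s

/-- A weaker form of `IsCrossRatioSystem`, which refers only to proper subsets of `S`. -/
structure IsLocalCrossRatioSystem {S : Type*} (T : S → S → S → S → OnePoint ℂ) : Prop where
  junk : ∀ a b c d, ¬ Distinct3 a b c → T a b c d = OnePoint.infty
  distinct3 : ∀ a b c, Distinct3 a b c → Distinct3 (T a b c a) (T a b c b) (T a b c c)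
  change : ∀ a b c x y z d, (∃ i, i ∉ [a, b, c, x, y, z, d]) → Distinct3 a b c →
    Distinct3 (T a b c x) (T a b c y) (T a b c z) →
    T x y z d = crossRatio (T a b c x) (T a b c y) (T a b c z) (T a b c d)

theorem exists_notMem_of_card {S : Type*} (hS : 6 ≤ Nat.card S) (a b c d e : S) :
    ∃ i, i ∉ [a, b, c, d, e] := by
  classical
  by_contra! h
  have : Finite S := Nat.finite_of_card_ne_zero (by omega)
  have := Fintype.ofFinite S
  have h1 : (Finset.univ : Finset S) ⊆ [a, b, c, d, e].toFinset := fun i _ => by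
    simpa using h i
  have h2 := (Finset.card_le_card h1).trans (List.toFinset_card_le _)
  rw [Finset.card_univ, ← Nat.card_eq_fintype_card] at h2
  simp only [List.length_cons, List.length_nil] at h2
  omega

namespace IsLocalCrossRatioSystem

variable {S : Type} {T : S → S → S → S → OnePoint ℂ}

theorem seenFrom_of_forall (hT : IsLocalCrossRatioSystem T) {f : S → OnePoint ℂ} {a b c x y z : S}
    (h : SeenFrom T f a b c) (h' : Distinct3 (f x) (f y) (f z))
    (hi : ∀ d, ∃ i, i ∉ [a, b, c, x, y, z, d]) : SeenFrom T f x y z := by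
  obtain ⟨h1, g, hg⟩ := h
  have h2 : Distinct3 (T a b c x) (T a b c y) (T a b c z) := by
    simp only [hg] at h'
    exact (distinct3_smul_iff g).1 h'
  obtain ⟨k, hk⟩ := exists_crossRatio_eq_smul h2
  refine ⟨h', g * k⁻¹, fun s => ?_⟩
  rw [hT.change a b c x y z s (hi s) (h1.of_map f) h2, hk, mul_smul, inv_smul_smul, hg]

theorem swap_left (hT : IsLocalCrossRatioSystem T) (hS : 6 ≤ Nat.card S) {f : S → OnePoint ℂ}
    {x y z : S} (h : SeenFrom T f x y z) : SeenFrom T f y x z := by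
  refine hT.seenFrom_of_forall h ⟨h.1.1.symm, h.1.2.2, h.1.2.1⟩ fun d => ?_
  obtain ⟨i, hi⟩ := exists_notMem_of_card hS x y z d d
  exact ⟨i, by simp at hi ⊢; tauto⟩

theorem swap_right (hT : IsLocalCrossRatioSystem T) (hS : 6 ≤ Nat.card S) {f : S → OnePoint ℂ}
    {x y z : S} (h : SeenFrom T f x y z) : SeenFrom T f x z y := by
  refine hT.seenFrom_of_forall h ⟨h.1.2.1, h.1.1, h.1.2.2.symm⟩ fun d => ?_
  obtain ⟨i, hi⟩ := exists_notMem_of_card hS x y z d d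
  exact ⟨i, by simp at hi ⊢; tauto⟩

/-- This is where six labels are needed: `x, y, z, a, d` must leave one label free for `change`. -/
theorem replace (hT : IsLocalCrossRatioSystem T) (hS : 6 ≤ Nat.card S) {f : S → OnePoint ℂ}
    {x y z a : S} (h : SeenFrom T f x y z) (hy : f a ≠ f y) (hz : f a ≠ f z) :
    SeenFrom T f a y z := by
  refine hT.seenFrom_of_forall h ⟨hy, hz, h.1.2.2⟩ fun d => ?_
  obtain ⟨i, hi⟩ := exists_notMem_of_card hS x y z a d
  exact ⟨i, by simp at hi ⊢; tauto⟩

/-- An exchange argument: a new label shares its direction with at most one label of the current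
triple, and that one is replaced. Labels already brought in are kept, as `a`, `b`, `c` have distinct
directions. -/
theorem seenFrom (hT : IsLocalCrossRatioSystem T) (hS : 6 ≤ Nat.card S) {f : S → OnePoint ℂ}
    {x y z a b c : S} (h : SeenFrom T f x y z) (h' : Distinct3 (f a) (f b) (f c)) :
    SeenFrom T f a b c := by
  obtain ⟨y, z, h⟩ : ∃ y z, SeenFrom T f a y z := by
    by_cases h1 : f a = f y
    · exact ⟨x, z, hT.replace hS (hT.swap_left hS h) (h1 ▸ h.1.1.symm) (h1 ▸ h.1.2.2)⟩
    by_cases h2 : f a = f z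
    · exact ⟨y, x, hT.replace hS (hT.swap_left hS (hT.swap_right hS (hT.swap_left hS h)))
        h1 (h2 ▸ h.1.2.1.symm)⟩
    exact ⟨y, z, hT.replace hS h h1 h2⟩
  obtain ⟨z, h⟩ : ∃ z, SeenFrom T f b a z := by
    by_cases h1 : f b = f z
    · exact ⟨y, hT.replace hS (hT.swap_left hS (hT.swap_right hS h)) h'.1.symm
        (h1 ▸ h.1.2.2.symm)⟩
    · exact ⟨z, hT.replace hS (hT.swap_left hS h) h'.1.symm h1⟩
  have h3 := hT.replace hS (hT.swap_left hS (hT.swap_right hS h)) h'.2.2.symm h'.2.1.symm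
  exact hT.swap_right hS (hT.swap_left hS (hT.swap_right hS h3))

/-- The set of the components of the curve that belongs to `T`. -/
def Component (T : S → S → S → S → OnePoint ℂ) : Type :=
  {o : MulAction.orbitRel.Quotient (GL (Fin 2) ℂ) (S → OnePoint ℂ) //
    ∃ a b c, Distinct3 a b c ∧ o = Quotient.mk _ (T a b c)}

/-- The map that assigns to each label the direction in which it is seen from a component. -/
noncomputable def family (T : S → S → S → S → OnePoint ℂ) (v : Component T) : S → OnePoint ℂ :=
  v.1.out

theorem exists_family_eq (v : Component T) {a b c : S} (h : v.1 = Quotient.mk _ (T a b c)) :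
    ∃ g : GL (Fin 2) ℂ, ∀ s, family T v s = g • T a b c s := by
  have h1 : Quotient.mk _ v.1.out = Quotient.mk _ (T a b c) := (Quotient.out_eq _).trans h
  obtain ⟨g, hg⟩ := MulAction.orbitRel_apply.1 (Quotient.exact h1)
  exact ⟨g, fun s => (congrFun hg s).symm⟩

theorem finite_component [Finite S] : Finite (Component T) := by
  refine Set.Finite.subset (Set.finite_range fun t : S × S × S =>
    (Quotient.mk _ (T t.1 t.2.1 t.2.2) :
      MulAction.orbitRel.Quotient (GL (Fin 2) ℂ) (S → OnePoint ℂ))) ?_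
  rintro _ ⟨a, b, c, -, rfl⟩
  exact ⟨(a, b, c), rfl⟩

theorem exists_component (hT : IsLocalCrossRatioSystem T) {a b c : S} (h : Distinct3 a b c) :
    ∃ v, SeenFrom T (family T v) a b c := by
  let v : Component T := ⟨Quotient.mk _ (T a b c), a, b, c, h, rfl⟩
  obtain ⟨g, hg⟩ := exists_family_eq v rfl
  refine ⟨v, ?_, g, hg⟩
  simp only [hg]
  exact (distinct3_smul_iff g).2 (hT.distinct3 a b c h)

theorem exists_seenFrom (hT : IsLocalCrossRatioSystem T) (v : Component T) :
    ∃ a b c, SeenFrom T (family T v) a b c := by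
  obtain ⟨a, b, c, h, h'⟩ := v.2
  obtain ⟨g, hg⟩ := exists_family_eq v h'
  refine ⟨a, b, c, ?_, g, hg⟩
  simp only [hg]
  exact (distinct3_smul_iff g).2 (hT.distinct3 a b c h)

/-- Two components that separate a common triple are both Möbius images of the same map `T x y z`,
by `seenFrom`, and so are equal. For distinct ones the Kőnig-type lemma yields `sep`. -/
theorem isStableFamily (hT : IsLocalCrossRatioSystem T) (hS : 6 ≤ Nat.card S) :
    IsStableFamily (family T) where
  three v := by
    obtain ⟨a, b, c, h⟩ := hT.exists_seenFrom v
    exact ⟨a, b, c, h.1⟩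
  sep v w hne := by
    obtain ⟨a, b, c, h⟩ := hT.exists_seenFrom v
    obtain ⟨a', b', c', h'⟩ := hT.exists_seenFrom w
    refine exists_cover_of_no_common_triple ⟨a, b, c, h.1⟩ ⟨a', b', c', h'.1⟩ ?_
    intro x y z hv hw
    obtain ⟨-, g, hg⟩ := hT.seenFrom hS h hv
    obtain ⟨-, k, hk⟩ := hT.seenFrom hS h' hw
    refine hne (Subtype.ext ?_)
    rw [← Quotient.out_eq v.1, ← Quotient.out_eq w.1]
    refine Quotient.sound (MulAction.orbitRel_apply.2 ⟨g * k⁻¹, funext fun s => ?_⟩)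
    change (g * k⁻¹) • family T w s = family T v s
    rw [hk, hg, mul_smul, inv_smul_smul]
  median a b c h := by
    obtain ⟨v, hv⟩ := hT.exists_component h
    exact ⟨v, hv.1⟩

/-- Each local system of cross-ratios on at least six labels comes from a stable curve. -/
theorem exists_curve {n : ℕ} (hn : 6 ≤ n) {T : Fin n → Fin n → Fin n → Fin n → OnePoint ℂ}
    (hT : IsLocalCrossRatioSystem T) :
    ∃ C : MarkedCurve n, C.IsStable ∧ C.crossRatios = T := by
  have hS : 6 ≤ Nat.card (Fin n) := by simpa using hn
  have hF := hT.isStableFamily hS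
  have := finite_component (T := T)
  have h3 : Distinct3 (⟨0, by omega⟩ : Fin n) ⟨1, by omega⟩ ⟨2, by omega⟩ := by
    simp [Distinct3]
  have : Nonempty (Component T) := ⟨(hT.exists_component h3).choose⟩
  refine ⟨hF.curve, hF.curve_isStable, ?_⟩
  funext a b c d
  by_cases h : Distinct3 a b c
  · obtain ⟨v, hv, g, hg⟩ := hT.exists_component h
    have key := fun s => hF.view_curve v s
    have h1 := hF.curve_isStable.crossRatios_eq (v := v) (a := a) (b := b) (c := c)
      (by rwa [key, key, key]) d
    rw [h1, key, key, key, key, hg, hg, hg, hg]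
    have h2 := hT.distinct3 a b c h
    -- The change from `a, b, c` to itself says that `T a b c` is already normalised as a
    -- cross-ratio.
    rw [crossRatio_smul h2, ← hT.change a b c a b c d ?_ h h2]
    obtain ⟨i, hi⟩ := exists_notMem_of_card hS a b c d d
    exact ⟨i, by simp at hi ⊢; tauto⟩
  · rw [MarkedCurve.crossRatios_of_not _ h, hT.junk _ _ _ _ h]

end IsLocalCrossRatioSystem

/-! ### Relabelling after two erasures -/

theorem Fin.val_lt_of_lt {n : ℕ} {i j : Fin (n + 2)} (hij : i < j) : i.val < n + 1 :=
  Nat.lt_of_lt_of_le hij (Nat.le_of_lt_succ j.2)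

theorem Fin.succAbove_castLT_succAbove {n : ℕ} {i j : Fin (n + 2)} (hij : i < j) (a : Fin n) :
    j.succAbove ((i.castLT (Fin.val_lt_of_lt hij) : Fin (n + 1)).succAbove a) =
      i.succAbove ((j.pred (Fin.ne_zero_of_lt hij)).succAbove a) := by
  simp only [Fin.ext_iff, Fin.succAbove, Fin.lt_def] at hij ⊢
  split_ifs <;> simp at * <;> omega

/-- The common value differs from `i` and from `j`, so it comes from a label that survives both
erasures. -/
theorem Fin.exists_of_succAbove_eq_succAbove {n : ℕ} {i j : Fin (n + 2)} (hij : i < j)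
    {a a' : Fin (n + 1)} (h : i.succAbove a = j.succAbove a') :
    ∃ b : Fin n,
      a' = (i.castLT (Fin.val_lt_of_lt hij) : Fin (n + 1)).succAbove b ∧
      a = (j.pred (Fin.ne_zero_of_lt hij)).succAbove b := by
  have h1 : a' ≠ i.castLT (Fin.val_lt_of_lt hij) := by
    rintro rfl
    have h2 : j.succAbove (i.castLT (Fin.val_lt_of_lt hij)) = i := by
      rw [Fin.succAbove_of_castSucc_lt _ _ (by simpa using hij)]
      simp
    exact Fin.succAbove_ne i a (h.trans h2)
  obtain ⟨b, rfl⟩ := Fin.exists_succAbove_eq h1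
  rw [Fin.succAbove_castLT_succAbove hij] at h
  exact ⟨b, rfl, Fin.succAbove_right_injective h⟩

/-! ### Gluing the faces -/

namespace MBar

/-- The system of the cross-ratios of a point of `M̄_{0,n}`. -/
noncomputable def crossRatios : ∀ n : ℕ, MBar n → Fin n → Fin n → Fin n → Fin n → OnePoint ℂ
  | _ + 3 => Quotient.lift (fun C => C.1.crossRatios) fun C _ ⟨φ⟩ => (φ.crossRatios_eq C.2).symm
  | 0 => fun _ _ _ _ _ => OnePoint.infty
  | 1 => fun _ _ _ _ _ => OnePoint.infty
  | 2 => fun _ _ _ _ _ => OnePoint.infty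

theorem crossRatios_injective : ∀ n : ℕ, Function.Injective (crossRatios n)
  | _ + 3 => by
    rintro ⟨C⟩ ⟨D⟩ h
    exact Quotient.sound (MarkedCurve.nonempty_iso_of_crossRatios_eq C.2 D.2 h)
  | 0 => fun _ _ _ => rfl
  | 1 => fun _ _ _ => rfl
  | 2 => fun _ _ _ => rfl

theorem not_distinct3_of_lt {n : ℕ} (hn : n < 3) (a b c : Fin n) : ¬ Distinct3 a b c := by
  simp only [Distinct3, Ne, Fin.ext_iff]
  omega

theorem isCrossRatioSystem : ∀ (n : ℕ) (y : MBar n), IsCrossRatioSystem (crossRatios n y)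
  | _ + 3, y => by
    obtain ⟨C⟩ := y
    exact C.2.isCrossRatioSystem
  | 0, _ => ⟨fun _ _ _ _ _ => rfl, fun _ _ _ h => absurd h (not_distinct3_of_lt (by omega) _ _ _),
      fun _ _ _ _ _ _ _ h => absurd h (not_distinct3_of_lt (by omega) _ _ _)⟩
  | 1, _ => ⟨fun _ _ _ _ _ => rfl, fun _ _ _ h => absurd h (not_distinct3_of_lt (by omega) _ _ _),
      fun _ _ _ _ _ _ _ h => absurd h (not_distinct3_of_lt (by omega) _ _ _)⟩
  | 2, _ => ⟨fun _ _ _ _ _ => rfl, fun _ _ _ h => absurd h (not_distinct3_of_lt (by omega) _ _ _),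
      fun _ _ _ _ _ _ _ h => absurd h (not_distinct3_of_lt (by omega) _ _ _)⟩

theorem crossRatios_forget (n : ℕ) (i : Fin (n + 1)) (y : MBar (n + 1)) (a b c d : Fin n) :
    crossRatios n (forget n i y) a b c d =
      crossRatios (n + 1) y (i.succAbove a) (i.succAbove b) (i.succAbove c) (i.succAbove d) := by
  by_cases hn : n < 3
  · have h := not_distinct3_of_lt hn a b c
    rw [(isCrossRatioSystem _ _).junk _ _ _ _ h, (isCrossRatioSystem _ _).junk]
    exact fun h' => h (h'.of_map i.succAbove)
  · obtain ⟨m, rfl⟩ := Nat.exists_eq_add_of_le' (not_lt.1 hn)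
    obtain ⟨C⟩ := y
    exact StableCurve.crossRatios_forget _ i C a b c d

theorem exists_crossRatios_eq {n : ℕ} (hn : 3 ≤ n) {C : MarkedCurve n} (hC : C.IsStable) :
    ∃ y : MBar n, crossRatios n y = C.crossRatios := by
  obtain ⟨m, rfl⟩ := Nat.exists_eq_add_of_le' hn
  exact ⟨Quotient.mk _ ⟨C, hC⟩, rfl⟩

theorem forget_forget (n : ℕ) {i j : Fin (n + 2)} (hij : i < j) (y : MBar (n + 2)) :
    forget n (i.castLT (Fin.val_lt_of_lt hij)) (forget (n + 1) j y) =
      forget n (j.pred (Fin.ne_zero_of_lt hij)) (forget (n + 1) i y) := by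
  apply crossRatios_injective
  funext a b c d
  simp only [crossRatios_forget, Fin.succAbove_castLT_succAbove hij]

/-- The simplicial equations, expressed by cross-ratios. -/
theorem crossRatios_eq_of_forget_eq {n : ℕ} {x : Fin (n + 2) → MBar (n + 1)}
    (hx : ∀ (i j : Fin (n + 2)) (hij : i < j), forget n (i.castLT (Fin.val_lt_of_lt hij)) (x j) =
      forget n (j.pred (Fin.ne_zero_of_lt hij)) (x i))
    {i j : Fin (n + 2)} {a b c d a' b' c' d' : Fin (n + 1)} (ha : i.succAbove a = j.succAbove a')
    (hb : i.succAbove b = j.succAbove b') (hc : i.succAbove c = j.succAbove c')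
    (hd : i.succAbove d = j.succAbove d') :
    crossRatios _ (x i) a b c d = crossRatios _ (x j) a' b' c' d' := by
  wlog hij : i ≤ j generalizing i j a b c d a' b' c' d'
  · exact (this ha.symm hb.symm hc.symm hd.symm (le_of_not_ge hij)).symm
  rcases hij.eq_or_lt with rfl | hij
  · have := Fin.succAbove_right_injective (p := i)
    rw [this ha, this hb, this hc, this hd]
  · obtain ⟨a, rfl, rfl⟩ := Fin.exists_of_succAbove_eq_succAbove hij ha
    obtain ⟨b, rfl, rfl⟩ := Fin.exists_of_succAbove_eq_succAbove hij hb
    obtain ⟨c, rfl, rfl⟩ := Fin.exists_of_succAbove_eq_succAbove hij hc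
    obtain ⟨d, rfl, rfl⟩ := Fin.exists_of_succAbove_eq_succAbove hij hd
    rw [← crossRatios_forget, ← crossRatios_forget, hx i j hij]

theorem eq_of_forget_eq {n : ℕ} (hn : 5 < n + 2) {y z : MBar (n + 2)}
    (h : ∀ i, forget (n + 1) i y = forget (n + 1) i z) : y = z := by
  apply crossRatios_injective
  funext a b c d
  obtain ⟨i, hi⟩ := exists_notMem_of_card (S := Fin (n + 2)) (by simpa using (by omega : 4 ≤ n)) a b c d d
  simp only [List.mem_cons, List.not_mem_nil, or_false, not_or] at hi
  obtain ⟨a, rfl⟩ := Fin.exists_succAbove_eq (Ne.symm hi.1)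
  obtain ⟨b, rfl⟩ := Fin.exists_succAbove_eq (Ne.symm hi.2.1)
  obtain ⟨c, rfl⟩ := Fin.exists_succAbove_eq (Ne.symm hi.2.2.1)
  obtain ⟨d, rfl⟩ := Fin.exists_succAbove_eq (Ne.symm hi.2.2.2.1)
  rw [← crossRatios_forget, ← crossRatios_forget, h]

theorem exists_forget_eq {n : ℕ} (hn : 5 < n + 2) {x : Fin (n + 2) → MBar (n + 1)}
    (hx : ∀ (i j : Fin (n + 2)) (hij : i < j), forget n (i.castLT (Fin.val_lt_of_lt hij)) (x j) =
      forget n (j.pred (Fin.ne_zero_of_lt hij)) (x i)) :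
    ∃ y : MBar (n + 2), ∀ i, forget (n + 1) i y = x i := by
  have card : 6 ≤ Nat.card (Fin (n + 2)) := by
    simpa using (by omega : 4 ≤ n)
  -- Four labels miss some `i`, so the value can be read off from the face `x i`; the simplicial
  -- equations make it independent of `i`.
  have glue : ∀ a b c d : Fin (n + 2), ∃ t, ∀ i a' b' c' d', i.succAbove a' = a →
      i.succAbove b' = b → i.succAbove c' = c → i.succAbove d' = d →
      t = crossRatios _ (x i) a' b' c' d' := by
    intro a b c d
    obtain ⟨i, hi⟩ := exists_notMem_of_card card a b c d d
    simp only [List.mem_cons, List.not_mem_nil, or_false, not_or] at hi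
    obtain ⟨a, rfl⟩ := Fin.exists_succAbove_eq (Ne.symm hi.1)
    obtain ⟨b, rfl⟩ := Fin.exists_succAbove_eq (Ne.symm hi.2.1)
    obtain ⟨c, rfl⟩ := Fin.exists_succAbove_eq (Ne.symm hi.2.2.1)
    obtain ⟨d, rfl⟩ := Fin.exists_succAbove_eq (Ne.symm hi.2.2.2.1)
    exact ⟨crossRatios _ (x i) a b c d, fun j a' b' c' d' ha hb hc hd =>
      crossRatios_eq_of_forget_eq hx ha.symm hb.symm hc.symm hd.symm⟩
  choose T hT using glue
  have hT' : ∀ i a b c d, T (i.succAbove a) (i.succAbove b) (i.succAbove c) (i.succAbove d) =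
      crossRatios _ (x i) a b c d := fun i a b c d => hT _ _ _ _ i a b c d rfl rfl rfl rfl
  -- Each axiom is checked within a single face `x i`, for a label `i` that does not occur in it.
  -- For `change` such an `i` has to be assumed, hence the local form.
  have loc : IsLocalCrossRatioSystem T := by
    refine ⟨fun a b c d h => ?_, fun a b c h => ?_, fun a b c p q r d hi h h' => ?_⟩
    · obtain ⟨i, hi⟩ := exists_notMem_of_card card a b c d d
      simp only [List.mem_cons, List.not_mem_nil, or_false, not_or] at hi
      obtain ⟨a, rfl⟩ := Fin.exists_succAbove_eq (Ne.symm hi.1)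
      obtain ⟨b, rfl⟩ := Fin.exists_succAbove_eq (Ne.symm hi.2.1)
      obtain ⟨c, rfl⟩ := Fin.exists_succAbove_eq (Ne.symm hi.2.2.1)
      obtain ⟨d, rfl⟩ := Fin.exists_succAbove_eq (Ne.symm hi.2.2.2.1)
      rw [hT', (isCrossRatioSystem _ _).junk]
      exact fun h' => h (h'.map Fin.succAbove_right_injective)
    · obtain ⟨i, hi⟩ := exists_notMem_of_card card a b c c c
      simp only [List.mem_cons, List.not_mem_nil, or_false, not_or] at hi
      obtain ⟨a, rfl⟩ := Fin.exists_succAbove_eq (Ne.symm hi.1)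
      obtain ⟨b, rfl⟩ := Fin.exists_succAbove_eq (Ne.symm hi.2.1)
      obtain ⟨c, rfl⟩ := Fin.exists_succAbove_eq (Ne.symm hi.2.2.1)
      rw [hT', hT', hT']
      exact (isCrossRatioSystem _ _).distinct3 _ _ _ (h.of_map _)
    · obtain ⟨i, hi⟩ := hi
      simp only [List.mem_cons, List.not_mem_nil, or_false, not_or] at hi
      obtain ⟨h1, h2, h3, h4, h5, h6, h7⟩ := hi
      obtain ⟨a, rfl⟩ := Fin.exists_succAbove_eq (Ne.symm h1)
      obtain ⟨b, rfl⟩ := Fin.exists_succAbove_eq (Ne.symm h2)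
      obtain ⟨c, rfl⟩ := Fin.exists_succAbove_eq (Ne.symm h3)
      obtain ⟨p, rfl⟩ := Fin.exists_succAbove_eq (Ne.symm h4)
      obtain ⟨q, rfl⟩ := Fin.exists_succAbove_eq (Ne.symm h5)
      obtain ⟨r, rfl⟩ := Fin.exists_succAbove_eq (Ne.symm h6)
      obtain ⟨d, rfl⟩ := Fin.exists_succAbove_eq (Ne.symm h7)
      simp only [hT'] at h' ⊢
      exact (isCrossRatioSystem _ _).change _ _ _ _ _ _ _ (h.of_map _) h'
  obtain ⟨C, hC, hCT⟩ := loc.exists_curve hn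
  obtain ⟨y, hy⟩ := exists_crossRatios_eq (by omega) hC
  refine ⟨y, fun i => crossRatios_injective _ ?_⟩
  funext a b c d
  rw [crossRatios_forget, hy, hCT, hT']

end MBar

theorem theorem2 :
    -- the simplicial identities hold
    IsDeltaSet MBarSimplex MBarFace ∧
    -- unique fillability in dimensions 5 and greater
    (∀ n : ℕ, 5 ≤ n → UniquelyFillable MBarSimplex MBarFace n) ∧
    -- for 5 < n + 2, the space with n + 2 marked points is cut out by the simplicial equations
    -- inside the product of n + 2 copies of the space with n + 1 marked points
    (∀ n : ℕ, 5 < n + 2 →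
      Function.Injective
        (fun (y : MBar (n + 2)) (i : Fin (n + 2)) => MBar.forget (n + 1) i y) ∧
      Set.range (fun (y : MBar (n + 2)) (i : Fin (n + 2)) => MBar.forget (n + 1) i y) =
        {x : Fin (n + 2) → MBar (n + 1) |
          ∀ (i j : Fin (n + 2)) (hij : i < j),
            MBar.forget n (i.castLT (by omega)) (x j) =
              MBar.forget n (j.pred (Fin.ne_zero_of_lt hij)) (x i)}) := by
  refine ⟨fun n i j hij x => MBar.forget_forget _ hij x, fun n hn => ?_, fun n hn => ⟨?_, ?_⟩⟩
  · obtain ⟨n, rfl⟩ := Nat.exists_eq_add_of_le' (show 2 ≤ n by omega)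
    intro x hx
    -- A simplex of dimension `n + 2` has `n + 3 = (n + 1) + 2` marked points, so dimension five
    -- means six points.
    obtain ⟨y, hy⟩ := MBar.exists_forget_eq (n := n + 1) (by omega) hx
    exact ⟨y, hy, fun z hz => MBar.eq_of_forget_eq (by omega) fun i => (hz i).trans (hy i).symm⟩
  · exact fun y z h => MBar.eq_of_forget_eq hn (congrFun h)
  · ext x
    constructor
    · rintro ⟨y, rfl⟩ i j hij
      exact MBar.forget_forget n hij y
    · intro hx
      obtain ⟨y, hy⟩ := MBar.exists_forget_eq hn hx
      exact ⟨y, funext hy⟩
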